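/- Probabilistic zero forcing on a finite simple graph $G$: some vertices are blue, the others white. In each time step every blue vertex $u$ independently forces each white neighbour $v$ to become blue with probability $C[u]/\deg u$, where $C[u]$ is the number of blue vertices in the closed neighbourhood of $u$; blue vertices stay blue. The propagation time of a set $S$ of initially blue vertices is the first time at which all vertices are blue, and $\mathrm{ept}(G)$ is the minimum over all vertices $v$ of the expected propagation time of $\{v\}$. Let $\log$ be the natural logarithm. (1) There is an absolute constant $C>0$ such that for every $d\ge 2$ and every connected $d$-regular graph $G$ on $n$ vertices, $$\mathrm{ept}(G)\le C\, n\,\frac{\log d}{d}.$$ (2) Explicitly, there is an absolute constant $A>0$ such that for every $d\ge 3$ and every connected $d$-regular graph $G$ on $n$ vertices, $$\mathrm{ept}(G)\le 60\,\frac{\log\frac{d+1}{3}}{d+1}\,n + A\log n .$$ (3) For $m\ge 1$ let $G_{m,d}$ be the following graph on $n=m(d+1)$ vertices: take copies $C_1,\dots,C_m$ of the complete graph $K_{d+1}$, choose two distinct vertices $v_{(i,1)},v_{(i,2)}$ in each $C_i$, delete the edge between $v_{(i,1)}$ and $v_{(i,2)}$ for every $i$, and then insert an edge between $v_{(i,1)}$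 and $v_{(i+1,2)}$ for every $i$ (indices modulo $m$). There is an absolute constant $c>0$ such that for all $d\ge 3$ and $m\ge 1$ the graph $G_{m,d}$ is connected and $d$-regular and $$\mathrm{ept}(G_{m,d})\ge c\, n\,\frac{\log\log d}{d}.$$ -/

import Mathlib

open MeasureTheory Finset
open scoped ENNReal unitInterval

namespace ZeroForcing

section Forcing

variable {V : Type*} [Fintype V] [DecidableEq V] (G : SimpleGraph V) [DecidableRel G.Adj]

/-- `C[u]`: the number of blue vertices in the closed neighbourhood of `u`, when the set of blue
vertices is `B`. -/
def closedBlueCount (B : Finset V) (u : V) : ℕ :=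
  #{w ∈ B | w = u ∨ G.Adj u w}

/-- The probability `C[u] / deg u` with which a blue vertex `u` forces each of its white
neighbours in one step. (It is at most `1` as soon as `u` has a white neighbour.) -/
noncomputable def forceProb (B : Finset V) (u : V) : ℝ :=
  (closedBlueCount G B u : ℝ) / (G.degree u : ℝ)

/-- One time step from the blue set `B`. The randomness of the step is a family of numbers
`x (u, v)` in the unit interval, one for every ordered pair of vertices; the blue vertex `u`
forces its neighbour `v` when `x (u, v) ≤ C[u] / deg u`. Blue vertices stay blue. -/
noncomputable def step (x : V × V → I) (B : Finset V) : Finset V :=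
  B ∪ Finset.univ.filter fun v => ∃ u ∈ B, G.Adj u v ∧ (x (u, v) : ℝ) ≤ forceProb G B u

/-- The sample space: for every time step, one number in `[0, 1]` for every ordered pair of
vertices. -/
abbrev Sample (V : Type*) : Type _ := ℕ → V × V → I

/-- The probability measure on the sample space under which all the numbers are independent and
uniformly distributed on `[0, 1]`. -/
noncomputable def sampleMeasure (V : Type*) [Fintype V] : Measure (Sample V) :=
  Measure.infinitePi fun _ : ℕ => Measure.pi fun _ : V × V => (volume : Measure I)

/-- The set of blue vertices after `t` steps of probabilistic zero forcing started from `S`. -/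
noncomputable def blue (S : Finset V) (ω : Sample V) : ℕ → Finset V
  | 0 => S
  | t + 1 => step G (ω t) (blue S ω t)

/-- The propagation time of `S`: the first time at which all the vertices are blue, and `∞` if
there is no such time. -/
noncomputable def propTime (S : Finset V) (ω : Sample V) : ℝ≥0∞ :=
  ⨅ (t : ℕ) (_ : blue G S ω t = Finset.univ), (t : ℝ≥0∞)

/-- The expected propagation time of the set `S`. -/
noncomputable def eptFrom (S : Finset V) : ℝ≥0∞ :=
  ∫⁻ ω, propTime G S ω ∂(sampleMeasure V)

/-- The expected propagation time of the graph: the minimum over all one-vertex initial sets. -/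
noncomputable def ept : ℝ≥0∞ :=
  ⨅ v : V, eptFrom G {v}

end Forcing

section Ring

/-- `m` disjoint copies of the complete graph on `d + 1` vertices. -/
def cliques (m d : ℕ) : SimpleGraph (Fin m × Fin (d + 1)) :=
  SimpleGraph.fromRel fun x y => x.1 = y.1

/-- In every copy `i`, the edge between the designated vertices `(i, 0)` and `(i, d)`. -/
def deletedEdges (m d : ℕ) : SimpleGraph (Fin m × Fin (d + 1)) :=
  SimpleGraph.fromRel fun x y => x.1 = y.1 ∧ x.2 = 0 ∧ y.2 = Fin.last d

/-- For every `i`, the edge between `(i, 0)` and `(i + 1, d)`, with `i + 1` taken modulo `m`. -/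
def insertedEdges (m d : ℕ) [NeZero m] : SimpleGraph (Fin m × Fin (d + 1)) :=
  SimpleGraph.fromRel fun x y => y.1 = x.1 + 1 ∧ x.2 = 0 ∧ y.2 = Fin.last d

/-- The ring of `m` copies of the complete graph on `d + 1` vertices: in each copy one edge is
removed, and one of its ends is joined to the other end of the edge removed from the next copy. -/
def ringOfCliques (m d : ℕ) [NeZero m] : SimpleGraph (Fin m × Fin (d + 1)) :=
  (cliques m d \ deletedEdges m d) ⊔ insertedEdges m d

instance (m d : ℕ) : DecidableRel (cliques m d).Adj :=
  fun x y => decidable_of_iff (x ≠ y ∧ (x.1 = y.1 ∨ y.1 = x.1)) Iff.rfl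

instance (m d : ℕ) : DecidableRel (deletedEdges m d).Adj :=
  fun x y => decidable_of_iff (x ≠ y ∧ ((x.1 = y.1 ∧ x.2 = 0 ∧ y.2 = Fin.last d) ∨
    (y.1 = x.1 ∧ y.2 = 0 ∧ x.2 = Fin.last d))) Iff.rfl

instance (m d : ℕ) [NeZero m] : DecidableRel (insertedEdges m d).Adj :=
  fun x y => decidable_of_iff (x ≠ y ∧ ((y.1 = x.1 + 1 ∧ x.2 = 0 ∧ y.2 = Fin.last d) ∨
    (x.1 = y.1 + 1 ∧ y.2 = 0 ∧ x.2 = Fin.last d))) Iff.rfl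

instance (m d : ℕ) [NeZero m] : DecidableRel (ringOfCliques m d).Adj :=
  fun x y => decidable_of_iff
    (((cliques m d).Adj x y ∧ ¬ (deletedEdges m d).Adj x y) ∨ (insertedEdges m d).Adj x y) Iff.rfl

end Ring

end ZeroForcing

/-!
Both bounds come from a potential of the blue set whose change in mean is controlled in every step.

For the upper bounds, give a blue vertex `u` the weight `2 * Δ ^ dist u w / C[u]` with respect to a
white target `w`. Let `u` have the smallest weight, and let `v` be the next vertex on a shortest
path from `u` to `w`. Either `u` forces `v`, and the weight drops because `v` is closer to `w`, or
`C[u]` grows because of the other neighbours that `u` forces. On average the smallest weight shrinks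
by the factor `3 / 4`. It is at least `1` while `w` is white, so the propagation time is of order
`diam G * log Δ + log n`, and the diameter of a connected graph with minimum degree `δ` is at most
`3 * n / (δ + 1)`.

For the lower bound, split the ring of cliques into layers by the distance of the cliques from the
initial one. While there are `b` blue vertices in the front layer, their number is at best squared
in a step, up to a constant factor, and the front advances with probability `O(b / d)`. Counting
blue vertices of the front layer on the scale `log (1 + log b)`, capped at half of its value for
`d + 1`, makes both effects bounded, so crossing each of the `m / 2` layers costs time of order
`log (log d)`.
-/

namespace ZeroForcing

theorem iInf_natCast_eq_tsum {p : ℕ → Prop} [DecidablePred p] (hp : Monotone p) :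
    ⨅ (t : ℕ) (_ : p t), (t : ℝ≥0∞) = ∑' t : ℕ, if p t then 0 else 1 := by
  by_cases h : ∃ t, p t
  · have hfind (t : ℕ) : p t ↔ Nat.find h ≤ t :=
      ⟨Nat.find_min' h, fun ht => hp ht (Nat.find_spec h)⟩
    have hsum : ∑' t : ℕ, (if p t then (0 : ℝ≥0∞) else 1) = Nat.find h := by
      rw [tsum_eq_sum (s := range (Nat.find h))
          fun t ht => if_pos ((hfind t).2 (by simpa using ht)),
        sum_congr rfl fun t ht => if_neg fun hpt => (mem_range.1 ht).not_ge ((hfind t).1 hpt)]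
      simp
    rw [hsum]
    exact le_antisymm (iInf₂_le (Nat.find h) (Nat.find_spec h))
      (le_iInf₂ fun t ht => Nat.cast_le.2 ((hfind t).1 ht))
  · push Not at h
    simp [h]

section Evolution

variable {V : Type*} [Fintype V] [DecidableEq V] (G : SimpleGraph V) [DecidableRel G.Adj]

/-- The law of the randomness of a single step. -/
noncomputable def stepMeasure (V : Type*) [Fintype V] : Measure (V × V → I) :=
  Measure.pi fun _ => volume

instance : IsProbabilityMeasure (stepMeasure V) := by
  unfold stepMeasure; infer_instance

instance : IsProbabilityMeasure (sampleMeasure V) := by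
  unfold sampleMeasure; infer_instance

theorem mem_step {x : V × V → I} {B : Finset V} {v : V} :
    v ∈ step G x B ↔ v ∈ B ∨ ∃ u ∈ B, G.Adj u v ∧ (x (u, v) : ℝ) ≤ forceProb G B u := by
  simp [step]

theorem subset_step (x : V × V → I) (B : Finset V) : B ⊆ step G x B :=
  subset_union_left

@[simp] theorem step_univ (x : V × V → I) : step G x univ = univ :=
  univ_subset_iff.1 (subset_step G x univ)

theorem measurable_step (B : Finset V) : Measurable fun x => step G x B := by
  have hforced (u v : V) : Measurable fun x : V × V → I => (x (u, v) : ℝ) ≤ forceProb G B u :=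
    measurableSet_setOfPred.1 (measurableSet_le (by fun_prop) measurable_const)
  simp only [measurable_finset_iff, mem_step]
  exact fun v => measurable_const.or <|
    .exists fun u => measurable_const.and (measurable_const.and (hforced u v))

theorem measurable_step_uncurry : Measurable fun p : Finset V × (V × V → I) => step G p.2 p.1 :=
  measurable_from_prod_countable_right (measurable_step G)

theorem measurable_blue (S : Finset V) (t : ℕ) : Measurable fun ω => blue G S ω t := by
  induction t with
  | zero => exact measurable_const
  | succ t ih =>
    exact ((measurable_step_uncurry G).comp (ih.prodMk (measurable_pi_apply t)) :)

theorem measurableSet_blue_ne_univ (S : Finset V) (t : ℕ) :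
    MeasurableSet {ω : Sample V | blue G S ω t ≠ univ} :=
  measurable_blue G S t (measurableSet_singleton univ).compl

theorem blue_congr (S : Finset V) {ω ω' : Sample V} {t : ℕ} (h : ∀ s < t, ω s = ω' s) :
    blue G S ω t = blue G S ω' t := by
  induction t with
  | zero => rfl
  | succ t ih => rw [blue, blue, h t t.lt_add_one, ih fun s hs => h s (by omega)]

theorem blue_mono (S : Finset V) (ω : Sample V) : Monotone (blue G S ω) :=
  monotone_nat_of_le_succ fun _ => subset_step G _ _

/-- The expectation of `F` after one step from `B`. -/
noncomputable def stepMean (F : Finset V → ℝ≥0∞) (B : Finset V) : ℝ≥0∞ :=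
  ∫⁻ x, F (step G x B) ∂(stepMeasure V)

theorem indepFun_blue (S : Finset V) (t : ℕ) :
    ProbabilityTheory.IndepFun (fun ω => blue G S ω t) (fun ω => ω t) (sampleMeasure V) := by
  have hindep : ProbabilityTheory.iIndepFun (fun (i : ℕ) (ω : Sample V) => ω i)
      (sampleMeasure V) :=
    ProbabilityTheory.iIndepFun_infinitePi (P := fun _ => stepMeasure V) (X := fun _ x => x)
      fun _ => measurable_id
  let extend : (range t → V × V → I) → Sample V :=
    fun y s => if h : s ∈ range t then y ⟨s, h⟩ else 0
  have hextend : Measurable extend := measurable_pi_lambda _ fun s => by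
    by_cases h : s ∈ range t <;> simp only [extend, h, dite_true, dite_false] <;> fun_prop
  have hblue : (fun ω => blue G S ω t) =
      (fun y => blue G S (extend y) t) ∘ fun ω s => ω s := by
    ext1 ω
    exact blue_congr G S fun s hs => by simp [extend, hs]
  rw [hblue]
  exact (hindep.indepFun_finset (range t) {t} (by simp) measurable_pi_apply).comp
    ((measurable_blue G S t).comp hextend) (measurable_pi_apply ⟨t, mem_singleton_self t⟩)

theorem lintegral_blue_succ (S : Finset V) (F : Finset V → ℝ≥0∞) (t : ℕ) :
    ∫⁻ ω, F (blue G S ω (t + 1)) ∂(sampleMeasure V) =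
      ∫⁻ ω, stepMean G F (blue G S ω t) ∂(sampleMeasure V) := by
  have hF : Measurable F := .of_discrete
  have hstep : Measurable fun p : Finset V × (V × V → I) => F (step G p.2 p.1) :=
    hF.comp (measurable_step_uncurry G)
  have hlaw : Measure.map (fun ω : Sample V => ω t) (sampleMeasure V) = stepMeasure V :=
    Measure.infinitePi_map_eval _ t
  calc ∫⁻ ω, F (step G (ω t) (blue G S ω t)) ∂(sampleMeasure V)
      = ∫⁻ p, F (step G p.2 p.1)
          ∂((sampleMeasure V).map fun ω => (blue G S ω t, ω t)) :=
        (lintegral_map hstep ((measurable_blue G S t).prodMk (measurable_pi_apply t))).symm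
    _ = ∫⁻ B, stepMean G F B ∂((sampleMeasure V).map fun ω => blue G S ω t) := by
        rw [(ProbabilityTheory.indepFun_iff_map_prod_eq_prod_map_map
          (measurable_blue G S t).aemeasurable (measurable_pi_apply t).aemeasurable).1
          (indepFun_blue G S t), hlaw, lintegral_prod _ hstep.aemeasurable]
        rfl
    _ = ∫⁻ ω, stepMean G F (blue G S ω t) ∂(sampleMeasure V) :=
        lintegral_map .of_discrete (measurable_blue G S t)

theorem eptFrom_eq_tsum (S : Finset V) :
    eptFrom G S = ∑' t : ℕ, sampleMeasure V {ω | blue G S ω t ≠ univ} := by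
  have hpropTime (ω : Sample V) :
      propTime G S ω = ∑' t : ℕ, if blue G S ω t = univ then 0 else 1 :=
    iInf_natCast_eq_tsum fun s t hst (hs : _ = _) =>
      univ_subset_iff.1 (hs.symm.subset.trans (blue_mono G S ω hst))
  have hindicator (ω : Sample V) (t : ℕ) : (if blue G S ω t = univ then (0 : ℝ≥0∞) else 1) =
      {ω | blue G S ω t ≠ univ}.indicator 1 ω := by
    by_cases h : blue G S ω t = univ <;> simp [h]
  simp only [eptFrom, hpropTime, hindicator]
  rw [lintegral_tsum fun t =>
    (measurable_one.indicator (measurableSet_blue_ne_univ G S t)).aemeasurable]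
  exact tsum_congr fun t => lintegral_indicator_one (measurableSet_blue_ne_univ G S t)

theorem lintegral_blue_le_pow {S : Finset V} {F : Finset V → ℝ≥0∞} {r : ℝ≥0∞}
    (hF : ∀ B, S ⊆ B → stepMean G F B ≤ r * F B) (t : ℕ) :
    ∫⁻ ω, F (blue G S ω t) ∂(sampleMeasure V) ≤ r ^ t * F S := by
  induction t with
  | zero => simp [blue]
  | succ t ih =>
    calc ∫⁻ ω, F (blue G S ω (t + 1)) ∂(sampleMeasure V)
        = ∫⁻ ω, stepMean G F (blue G S ω t) ∂(sampleMeasure V) := lintegral_blue_succ G S F t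
      _ ≤ ∫⁻ ω, r * F (blue G S ω t) ∂(sampleMeasure V) :=
          lintegral_mono fun ω => hF _ (blue_mono G S ω (Nat.zero_le t))
      _ = r * ∫⁻ ω, F (blue G S ω t) ∂(sampleMeasure V) :=
          lintegral_const_mul _ (Measurable.of_discrete.comp (measurable_blue G S t))
      _ ≤ r ^ (t + 1) * F S := by rw [pow_succ', mul_assoc]; gcongr

theorem lintegral_blue_le_add {S : Finset V} {F : Finset V → ℝ≥0∞} {D : ℝ≥0∞}
    (hF : ∀ B, S ⊆ B → B ≠ univ → stepMean G F B ≤ F B + D) (t : ℕ) :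
    ∫⁻ ω, F (blue G S ω t) ∂(sampleMeasure V) ≤
      F S + D * ∑ s ∈ range t, sampleMeasure V {ω | blue G S ω s ≠ univ} := by
  induction t with
  | zero => simp [blue]
  | succ t ih =>
    have hmeas := measurableSet_blue_ne_univ G S t
    have hF_meas : Measurable fun ω => F (blue G S ω t) :=
      Measurable.of_discrete.comp (measurable_blue G S t)
    have hstep (ω : Sample V) : stepMean G F (blue G S ω t) ≤
        F (blue G S ω t) + D * {ω | blue G S ω t ≠ univ}.indicator 1 ω := by
      by_cases h : blue G S ω t = univ
      · simp [h, stepMean]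
      · simpa [h] using hF _ (blue_mono G S ω (Nat.zero_le t)) h
    calc ∫⁻ ω, F (blue G S ω (t + 1)) ∂(sampleMeasure V)
        = ∫⁻ ω, stepMean G F (blue G S ω t) ∂(sampleMeasure V) := lintegral_blue_succ G S F t
      _ ≤ ∫⁻ ω, F (blue G S ω t) + D * {ω | blue G S ω t ≠ univ}.indicator 1 ω
            ∂(sampleMeasure V) := lintegral_mono hstep
      _ = ∫⁻ ω, F (blue G S ω t) ∂(sampleMeasure V) +
            D * sampleMeasure V {ω | blue G S ω t ≠ univ} := by
          rw [lintegral_add_left hF_meas,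
            lintegral_const_mul _ (measurable_one.indicator hmeas), lintegral_indicator_one hmeas]
      _ ≤ _ := by rw [sum_range_succ, mul_add, ← add_assoc]; gcongr

theorem mul_one_sub_le_lintegral_blue (S : Finset V) (F : Finset V → ℝ≥0∞) (t : ℕ) :
    F univ * (1 - sampleMeasure V {ω | blue G S ω t ≠ univ}) ≤
      ∫⁻ ω, F (blue G S ω t) ∂(sampleMeasure V) := by
  have hmeas := measurableSet_blue_ne_univ G S t
  rw [← prob_compl_eq_one_sub hmeas, ← lintegral_indicator_one hmeas.compl,
    ← lintegral_const_mul _ (measurable_one.indicator hmeas.compl)]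
  exact lintegral_mono fun ω => by by_cases h : blue G S ω t = univ <;> simp [h]

theorem le_add_mul_eptFrom {S : Finset V} {F : Finset V → ℝ≥0∞} {D : ℝ≥0∞} (hD : D ≠ 0)
    (hF : ∀ B, S ⊆ B → B ≠ univ → stepMean G F B ≤ F B + D) :
    F univ ≤ F S + D * eptFrom G S := by
  rcases eq_or_ne (eptFrom G S) ∞ with htop | htop
  · simp [htop, ENNReal.mul_top hD]
  rw [eptFrom_eq_tsum] at htop ⊢
  have hbound (t : ℕ) : F univ * (1 - sampleMeasure V {ω | blue G S ω t ≠ univ}) ≤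
      F S + D * ∑' s, sampleMeasure V {ω | blue G S ω s ≠ univ} := by
    refine (mul_one_sub_le_lintegral_blue G S F t).trans
      ((lintegral_blue_le_add G hF t).trans ?_)
    gcongr
    exact ENNReal.sum_le_tsum _
  have hlim : Filter.Tendsto (fun t => F univ * (1 - sampleMeasure V {ω | blue G S ω t ≠ univ}))
      Filter.atTop (nhds (F univ * (1 - 0))) :=
    ENNReal.Tendsto.const_mul (ENNReal.Tendsto.sub tendsto_const_nhds
      (ENNReal.tendsto_atTop_zero_of_tsum_ne_top htop) (by simp)) (by simp)
  simpa using le_of_tendsto' hlim hbound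

end Evolution

section Step

theorem volume_setOf_coe_le {p : ℝ} (hp₀ : 0 ≤ p) (hp₁ : p ≤ 1) :
    volume {z : I | (z : ℝ) ≤ p} = ENNReal.ofReal p :=
  unitInterval.volume_Iic (x := ⟨p, hp₀, hp₁⟩)

theorem lintegral_unitInterval_ite {p : ℝ} (hp₀ : 0 ≤ p) (hp₁ : p ≤ 1) (a b : ℝ≥0∞) :
    ∫⁻ z : I, (if (z : ℝ) ≤ p then a else b) =
      a * ENNReal.ofReal p + b * ENNReal.ofReal (1 - p) := by
  have hmeas : MeasurableSet {z : I | (z : ℝ) ≤ p} :=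
    measurableSet_le measurable_subtype_coe measurable_const
  have hcompl : volume {z : I | (z : ℝ) ≤ p}ᶜ = ENNReal.ofReal (1 - p) := by
    rw [prob_compl_eq_one_sub hmeas, volume_setOf_coe_le hp₀ hp₁, ← ENNReal.ofReal_one,
      ENNReal.ofReal_sub _ hp₀]
  have hle : ∫⁻ z in {z : I | (z : ℝ) ≤ p}, (if (z : ℝ) ≤ p then a else b) =
      ∫⁻ _ in {z : I | (z : ℝ) ≤ p}, a := setLIntegral_congr_fun hmeas fun z hz => if_pos hz
  have hgt : ∫⁻ z in {z : I | (z : ℝ) ≤ p}ᶜ, (if (z : ℝ) ≤ p then a else b) =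
      ∫⁻ _ in {z : I | (z : ℝ) ≤ p}ᶜ, b := setLIntegral_congr_fun hmeas.compl fun z hz => if_neg hz
  rw [← lintegral_add_compl _ hmeas, hle, hgt, setLIntegral_const, setLIntegral_const,
    volume_setOf_coe_le hp₀ hp₁, hcompl]

theorem lintegral_pi_prod_ite {ι : Type*} [Fintype ι] (s : Finset ι) {p : ℝ} (hp₀ : 0 ≤ p)
    (hp₁ : p ≤ 1) (a b : ι → ℝ≥0∞) :
    ∫⁻ x : ι → I, ∏ i ∈ s, (if (x i : ℝ) ≤ p then a i else b i) =
      ∏ i ∈ s, (a i * ENNReal.ofReal p + b i * ENNReal.ofReal (1 - p)) := by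
  let f (i : ι) (z : I) : ℝ≥0∞ := if (z : ℝ) ≤ p then a i else b i
  have hf (i : ι) : Measurable (f i) :=
    .ite (measurableSet_le measurable_subtype_coe measurable_const) measurable_const
      measurable_const
  have hindep : ProbabilityTheory.iIndepFun (fun i (x : ι → I) => f i (x i)) volume :=
    ProbabilityTheory.iIndepFun_pi fun i => (hf i).aemeasurable
  refine (ProbabilityTheory.lintegral_prod_eq_prod_lintegral_of_indepFun s _ hindep
    fun i => (hf i).comp (measurable_pi_apply i)).trans (prod_congr rfl fun i _ => ?_)
  exact ((measurePreserving_eval (fun _ => volume) i).lintegral_comp (hf i)).trans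
    (lintegral_unitInterval_ite hp₀ hp₁ _ _)

variable {V : Type*} [Fintype V]

theorem lintegral_stepMeasure_ite (e : V × V) {p : ℝ} (hp₀ : 0 ≤ p) (hp₁ : p ≤ 1)
    (a b : ℝ≥0∞) :
    ∫⁻ x, (if (x e : ℝ) ≤ p then a else b) ∂(stepMeasure V) =
      a * ENNReal.ofReal p + b * ENNReal.ofReal (1 - p) := by
  have := lintegral_pi_prod_ite {e} hp₀ hp₁ (fun _ => a) (fun _ => b)
  simp only [prod_singleton] at this
  exact this

theorem lintegral_stepMeasure_ite_mul_prod (u : V) {v : V} {W : Finset V} (hv : v ∉ W) {p : ℝ}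
    (hp₀ : 0 ≤ p) (hp₁ : p ≤ 1) (q : ℝ≥0∞) :
    ∫⁻ x, (if (x (u, v) : ℝ) ≤ p then 0 else 1) *
        ∏ y ∈ W, (if (x (u, y) : ℝ) ≤ p then q else 1) ∂(stepMeasure V) =
      ENNReal.ofReal (1 - p) * (q * ENNReal.ofReal p + ENNReal.ofReal (1 - p)) ^ #W := by
  classical
  have hne {y : V} (hy : y ∈ W) : y ≠ v := fun h => hv (h ▸ hy)
  have := lintegral_pi_prod_ite ((W.cons v hv).map (.sectR u V)) hp₀ hp₁
    (fun e => if e.2 = v then 0 else q) (fun _ => 1)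
  simp only [prod_map, prod_cons, Function.Embedding.sectR_apply, if_true, zero_mul, one_mul,
    zero_add] at this
  rw [prod_congr rfl fun y hy => by rw [if_neg (hne hy)], prod_const] at this
  rw [← this]
  exact lintegral_congr fun x => congrArg _ (prod_congr rfl fun y hy => by rw [if_neg (hne hy)])

theorem lintegral_stepMeasure_forced_add_unforced (u : V) {v : V} {W : Finset V} (hv : v ∉ W)
    {p q : ℝ} (hp₀ : 0 ≤ p) (hp₁ : p ≤ 1) (hq : 0 ≤ q) :
    ∫⁻ x, (if (x (u, v) : ℝ) ≤ p then ENNReal.ofReal p else 1) +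
        (if (x (u, v) : ℝ) ≤ p then 0 else 1) *
          ∏ y ∈ W, (if (x (u, y) : ℝ) ≤ p then ENNReal.ofReal q else 1) ∂(stepMeasure V) =
      ENNReal.ofReal (p * p + (1 - p) + (1 - p) * (q * p + (1 - p)) ^ #W) := by
  have hp₁' : 0 ≤ 1 - p := sub_nonneg.2 hp₁
  have hmeas : Measurable fun x : V × V → I =>
      if (x (u, v) : ℝ) ≤ p then ENNReal.ofReal p else 1 :=
    .ite (measurableSet_le (by fun_prop) measurable_const) measurable_const measurable_const
  rw [lintegral_add_left hmeas, lintegral_stepMeasure_ite _ hp₀ hp₁,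
    lintegral_stepMeasure_ite_mul_prod u hv hp₀ hp₁, one_mul, ← ENNReal.ofReal_mul hp₀,
    ← ENNReal.ofReal_mul hq, ← ENNReal.ofReal_add (by positivity) hp₁',
    ← ENNReal.ofReal_add (by positivity) hp₁', ← ENNReal.ofReal_pow (by positivity),
    ← ENNReal.ofReal_mul hp₁', ← ENNReal.ofReal_add (by positivity) (by positivity)]

theorem stepMeasure_forced_le (p : ℝ) (e : V × V) :
    stepMeasure V {x | (x e : ℝ) ≤ p} ≤ ENNReal.ofReal p := by
  have hlaw : stepMeasure V {x | (x e : ℝ) ≤ p} = volume {z : I | (z : ℝ) ≤ p} :=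
    (measurePreserving_eval (fun _ : V × V => (volume : Measure I)) e).measure_preimage
      (measurableSet_le measurable_subtype_coe measurable_const).nullMeasurableSet
  rcases le_total 1 p with hp₁ | hp₁
  · exact prob_le_one.trans (by simpa using hp₁)
  rcases le_or_gt 0 p with hp₀ | hp₀
  · rw [hlaw, volume_setOf_coe_le hp₀ hp₁]
  · have hempty : {z : I | (z : ℝ) ≤ p} = ∅ :=
      Set.eq_empty_of_forall_notMem fun z hz => (hp₀.trans_le z.2.1).not_ge hz
    simp [hlaw, hempty]

end Step

section BlueCount

variable {V : Type*} [DecidableEq V] (G : SimpleGraph V) [DecidableRel G.Adj]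

theorem one_le_closedBlueCount {B : Finset V} {u : V} (hu : u ∈ B) :
    1 ≤ closedBlueCount G B u :=
  one_le_card.2 ⟨u, by simp [hu]⟩

theorem two_le_closedBlueCount {B : Finset V} {u v : V} (hu : u ∈ B) (hv : v ∈ B)
    (huv : G.Adj u v) : 2 ≤ closedBlueCount G B v := by
  rw [← card_pair huv.ne]
  refine card_le_card fun w => ?_
  simp only [mem_insert, mem_singleton, mem_filter]
  rintro (rfl | rfl) <;> simp [*, huv.symm]

variable [Fintype V]

theorem closedBlueCount_of_mem {B : Finset V} {u : V} (hu : u ∈ B) :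
    closedBlueCount G B u = #(B ∩ G.neighborFinset u) + 1 := by
  rw [← card_insert_of_notMem (a := u) (by simp)]
  refine congrArg card (Finset.ext fun w => ?_)
  simp only [mem_filter, mem_insert, mem_inter, SimpleGraph.mem_neighborFinset]
  constructor
  · tauto
  · rintro (rfl | h) <;> tauto

theorem closedBlueCount_le_degree_add_one (B : Finset V) (u : V) :
    closedBlueCount G B u ≤ G.degree u + 1 := by
  rw [← G.card_neighborFinset_eq_degree, ← card_insert_of_notMem (a := u) (by simp)]
  exact card_le_card fun w => by simp

theorem closedBlueCount_add_card_white {B : Finset V} {u v : V} (hu : u ∈ B) (hv : v ∉ B)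
    (huv : G.Adj u v) :
    closedBlueCount G B u + #((G.neighborFinset u \ B).erase v) = G.degree u := by
  have hblue := closedBlueCount_of_mem G hu
  have herase := card_erase_add_one (s := G.neighborFinset u \ B) (a := v) (by simp [huv, hv])
  have hsplit := card_sdiff_add_card_inter (G.neighborFinset u) B
  rw [inter_comm, G.card_neighborFinset_eq_degree] at hsplit
  omega

theorem forceProb_eq_one_sub {B : Finset V} {u v : V} (hu : u ∈ B) (hv : v ∉ B)
    (huv : G.Adj u v) :
    forceProb G B u = 1 - #((G.neighborFinset u \ B).erase v) / (G.degree u : ℝ) := by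
  have hdeg : (G.degree u : ℝ) ≠ 0 :=
    Nat.cast_ne_zero.2 ((G.degree_pos_iff_exists_adj u).2 ⟨v, huv⟩).ne'
  rw [forceProb, eq_sub_iff_add_eq, ← add_div, div_eq_one_iff_eq hdeg]
  exact_mod_cast closedBlueCount_add_card_white G hu hv huv

theorem closedBlueCount_add_card_forced_le {B W : Finset V} {u : V} (hu : u ∈ B)
    (hW : W ⊆ G.neighborFinset u \ B) (x : V × V → I) :
    closedBlueCount G B u + #{y ∈ W | (x (u, y) : ℝ) ≤ forceProb G B u} ≤
      closedBlueCount G (step G x B) u := by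
  have hWB {y : V} (hy : y ∈ W) : G.Adj u y ∧ y ∉ B := by simpa using hW hy
  rw [closedBlueCount_of_mem G hu, closedBlueCount_of_mem G (subset_step G x B hu),
    add_right_comm, ← card_union_of_disjoint]
  · gcongr
    intro y
    simp only [mem_union, mem_inter, mem_filter, SimpleGraph.mem_neighborFinset, mem_step]
    rintro (⟨hy, huy⟩ | ⟨hy, hforced⟩)
    · exact ⟨Or.inl hy, huy⟩
    · exact ⟨Or.inr ⟨u, hu, (hWB hy).1, hforced⟩, (hWB hy).1⟩
  · exact disjoint_left.2 fun y hy hyW =>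
      (hWB (mem_filter.1 hyW).1).2 (mem_inter.1 hy).1

end BlueCount

section Contraction

theorem two_mul_div_add_le {c : ℝ} (hc : 1 ≤ c) (k : ℕ) :
    2 * c / (c + k) ≤ 1 + (1 - 1 / c) ^ k := by
  have hc₀ : 0 < c := one_pos.trans_le hc
  have hc_inv : 1 / c ≤ 1 := (div_le_one hc₀).2 hc
  have hbernoulli : 1 - k / c ≤ (1 - 1 / c) ^ k := by
    have := one_add_mul_le_pow (a := -(1 / c)) (by linarith) k
    calc 1 - k / c = 1 + k * -(1 / c) := by ring
      _ ≤ (1 + -(1 / c)) ^ k := this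
      _ = (1 - 1 / c) ^ k := by ring
  have hpow : 0 ≤ (1 - 1 / c) ^ k := pow_nonneg (by linarith) k
  rcases le_total c k with h | h
  · calc 2 * c / (c + k) ≤ 1 := by rw [div_le_one (by positivity)]; linarith
      _ ≤ 1 + (1 - 1 / c) ^ k := by linarith
  · have hk : k / c ≤ 1 := (div_le_one hc₀).2 h
    have hnonneg : 0 ≤ k * (1 - k / c) := mul_nonneg k.cast_nonneg (by linarith)
    rw [div_le_iff₀ (by positivity)]
    calc 2 * c ≤ 2 * c + k * (1 - k / c) := by linarith
      _ = (1 + (1 - k / c)) * (c + k) := by field_simp; ring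
      _ ≤ (1 + (1 - 1 / c) ^ k) * (c + k) := by gcongr

theorem one_sub_one_div_pow_le {e : ℝ} (he : 1 ≤ e) (n : ℕ) :
    (1 - 1 / e) ^ n ≤ 1 / (1 + n / e) := by
  have he₀ : 0 < e := one_pos.trans_le he
  have he_inv : 1 / e ≤ 1 := (div_le_one he₀).2 he
  have he_inv₀ : 0 ≤ 1 / e := by positivity
  have hbernoulli : 1 + n / e ≤ (1 + 1 / e) ^ n := by
    simpa [div_eq_mul_inv] using one_add_mul_le_pow (a := 1 / e) (by linarith) n
  rw [le_div_iff₀ (by positivity)]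
  calc (1 - 1 / e) ^ n * (1 + n / e) ≤ (1 - 1 / e) ^ n * (1 + 1 / e) ^ n :=
        mul_le_mul_of_nonneg_left hbernoulli (pow_nonneg (by linarith) n)
    _ = (1 - (1 / e) ^ 2) ^ n := by rw [← mul_pow]; ring
    _ ≤ 1 := pow_le_one₀ (by nlinarith) (by nlinarith)

theorem mul_self_add_one_sub_add_mul_pow_le {p e : ℝ} {n : ℕ} (he : 1 ≤ e) (hp₀ : 0 ≤ p)
    (hp : p = 1 - n / e) :
    p * p + (1 - p) + (1 - p) * (1 - 1 / e) ^ n ≤ 3 / 2 := by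
  set s := n / e
  have hs₀ : 0 ≤ s := by positivity
  have hs₁ : s ≤ 1 := by linarith
  have hrational : s * (1 / (1 + s)) ≤ 1 / 2 + s - s ^ 2 := by
    rw [mul_one_div, div_le_iff₀ (by linarith)]
    nlinarith [mul_nonneg hs₀ (sub_nonneg.2 hs₁), mul_nonneg (sq_nonneg s) (sub_nonneg.2 hs₁)]
  calc p * p + (1 - p) + (1 - p) * (1 - 1 / e) ^ n
      = (1 - s) * (1 - s) + s + s * (1 - 1 / e) ^ n := by rw [hp]; ring
    _ ≤ (1 - s) * (1 - s) + s + s * (1 / (1 + s)) := by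
        gcongr; exact one_sub_one_div_pow_le he n
    _ ≤ 3 / 2 := by linarith

end Contraction

theorem exists_adj_dist_eq_add_one {V : Type*} {G : SimpleGraph V} (hG : G.Connected) {u w : V}
    (huw : u ≠ w) : ∃ v, G.Adj u v ∧ G.dist u w = G.dist v w + 1 := by
  obtain ⟨p, hp⟩ := hG.exists_walk_length_eq_dist u w
  cases p with
  | nil => exact absurd rfl huw
  | @cons _ v _ huv q =>
    refine ⟨v, huv, le_antisymm ?_ ?_⟩
    · simpa [SimpleGraph.dist_eq_one_iff_adj.2 huv, add_comm] using
        hG.dist_triangle (u := u) (v := v) (w := w)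
    · rw [← hp, SimpleGraph.Walk.length_cons]
      exact Nat.succ_le_succ (SimpleGraph.dist_le q)

section Potential

variable {V : Type*} [DecidableEq V] (G : SimpleGraph V) [DecidableRel G.Adj]

/-- An upper bound, up to a constant factor, for the time that the blue vertex `u` needs to turn
`w` blue along a shortest path in a graph of maximum degree `Δ`, on an exponential scale. -/
noncomputable def pathWeight (Δ : ℕ) (w : V) (B : Finset V) (u : V) : ℝ :=
  2 * (Δ : ℝ) ^ G.dist u w / closedBlueCount G B u

/-- The potential of the target `w`: the smallest weight of a blue vertex, and `0` once `w` is
blue. It is at least `1` while `w` is white, and contracts in mean in every step. -/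
noncomputable def pathPotential (Δ : ℕ) (w : V) (B : Finset V) : ℝ≥0∞ :=
  if w ∈ B then 0 else ⨅ u ∈ B, ENNReal.ofReal (pathWeight G Δ w B u)

theorem pathPotential_le {Δ : ℕ} {w u : V} {B : Finset V} (hu : u ∈ B) :
    pathPotential G Δ w B ≤ ENNReal.ofReal (pathWeight G Δ w B u) := by
  unfold pathPotential
  split_ifs
  · exact zero_le
  · exact iInf₂_le u hu

theorem pathPotential_singleton_le {Δ L : ℕ} (hΔ : 1 ≤ Δ) {s w : V} (hL : G.dist s w ≤ L) :
    pathPotential G Δ w {s} ≤ ENNReal.ofReal (2 * (Δ : ℝ) ^ L) := by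
  refine (pathPotential_le G (mem_singleton_self s)).trans (ENNReal.ofReal_le_ofReal ?_)
  have hcount : (1 : ℝ) ≤ closedBlueCount G {s} s := by
    exact_mod_cast one_le_closedBlueCount G (mem_singleton_self s)
  exact (div_le_self (by positivity) hcount).trans
    (mul_le_mul_of_nonneg_left (pow_le_pow_right₀ (by exact_mod_cast hΔ) hL) zero_le_two)

theorem pathWeight_le_pow_dist {Δ : ℕ} {w u v : V} {B : Finset V} (hu : u ∈ B) (hv : v ∈ B)
    (huv : G.Adj u v) : pathWeight G Δ w B v ≤ (Δ : ℝ) ^ G.dist v w := by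
  have hcount : (2 : ℝ) ≤ closedBlueCount G B v := by
    exact_mod_cast two_le_closedBlueCount G hu hv huv
  rw [pathWeight, div_le_iff₀ (by linarith), mul_comm]
  gcongr

variable [Fintype V] {G}

theorem one_le_pathPotential (hG : G.Connected) {Δ : ℕ} (hΔ : 1 ≤ Δ)
    (hdeg : ∀ u, G.degree u ≤ Δ) {w : V} {B : Finset V} (hw : w ∉ B) :
    1 ≤ pathPotential G Δ w B := by
  rw [pathPotential, if_neg hw]
  refine le_iInf₂ fun u hu => ?_
  have hcount : (closedBlueCount G B u : ℝ) ≤ Δ + 1 := by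
    exact_mod_cast (closedBlueCount_le_degree_add_one G B u).trans (Nat.succ_le_succ (hdeg u))
  have hcount₁ : (1 : ℝ) ≤ closedBlueCount G B u := by
    exact_mod_cast one_le_closedBlueCount G hu
  have hΔ' : (1 : ℝ) ≤ Δ := by exact_mod_cast hΔ
  have hdist : G.dist u w ≠ 0 := (hG.pos_dist_of_ne (ne_of_mem_of_not_mem hu hw)).ne'
  rw [ENNReal.one_le_ofReal, pathWeight, one_le_div (by linarith)]
  linarith [le_self_pow₀ hΔ' hdist]

theorem notMem_of_pathWeight_le {Δ : ℕ} (hΔ : 2 ≤ Δ) {w u v : V} {B : Finset V}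
    (hdeg : G.degree u ≤ Δ) (hu : u ∈ B)
    (hmin : ∀ y ∈ B, pathWeight G Δ w B u ≤ pathWeight G Δ w B y) (huv : G.Adj u v)
    (hdist : G.dist u w = G.dist v w + 1) : v ∉ B := by
  intro hv
  have hcount : (closedBlueCount G B u : ℝ) ≤ Δ + 1 := by
    exact_mod_cast (closedBlueCount_le_degree_add_one G B u).trans (Nat.succ_le_succ hdeg)
  have hcount₁ : (1 : ℝ) ≤ closedBlueCount G B u := by
    exact_mod_cast one_le_closedBlueCount G hu
  have hΔ' : (2 : ℝ) ≤ Δ := by exact_mod_cast hΔ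
  have hpow : (0 : ℝ) < Δ ^ G.dist v w := by positivity
  have hle := (hmin v hv).trans (pathWeight_le_pow_dist G hu hv huv)
  rw [pathWeight, hdist, div_le_iff₀ (by linarith), pow_succ] at hle
  nlinarith

theorem pathWeight_step_le {Δ : ℕ} {w u : V} {B W : Finset V} (hu : u ∈ B)
    (hW : W ⊆ G.neighborFinset u \ B) (x : V × V → I) :
    pathWeight G Δ w (step G x B) u ≤ pathWeight G Δ w B u / 2 *
      (1 + (1 - 1 / (closedBlueCount G B u : ℝ)) ^
        #{y ∈ W | (x (u, y) : ℝ) ≤ forceProb G B u}) := by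
  have hgrow : (closedBlueCount G B u : ℝ) + #{y ∈ W | (x (u, y) : ℝ) ≤ forceProb G B u} ≤
      closedBlueCount G (step G x B) u := by
    exact_mod_cast closedBlueCount_add_card_forced_le G hu hW x
  set c : ℝ := (closedBlueCount G B u : ℝ)
  set k := #{y ∈ W | (x (u, y) : ℝ) ≤ forceProb G B u}
  have hc : 1 ≤ c := Nat.one_le_cast.2 (one_le_closedBlueCount G hu)
  calc 2 * (Δ : ℝ) ^ G.dist u w / closedBlueCount G (step G x B) u
      ≤ 2 * (Δ : ℝ) ^ G.dist u w / (c + k) := by gcongr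
    _ = 2 * (Δ : ℝ) ^ G.dist u w / c / 2 * (2 * c / (c + k)) := by field_simp
    _ ≤ 2 * (Δ : ℝ) ^ G.dist u w / c / 2 * (1 + (1 - 1 / c) ^ k) := by
        gcongr; exact two_mul_div_add_le hc k

theorem pathPotential_step_le {Δ : ℕ} {w u v : V} {B W : Finset V} (hdeg : G.degree u ≤ Δ)
    (hu : u ∈ B) (huv : G.Adj u v) (hdist : G.dist u w = G.dist v w + 1)
    (hW : W ⊆ G.neighborFinset u \ B) (x : V × V → I) :
    pathPotential G Δ w (step G x B) ≤ ENNReal.ofReal (pathWeight G Δ w B u / 2) *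
      ((if (x (u, v) : ℝ) ≤ forceProb G B u then ENNReal.ofReal (forceProb G B u) else 1) +
        (if (x (u, v) : ℝ) ≤ forceProb G B u then 0 else 1) *
          ∏ y ∈ W, if (x (u, y) : ℝ) ≤ forceProb G B u then
            ENNReal.ofReal (1 - 1 / (closedBlueCount G B u : ℝ)) else 1) := by
  have hc : (1 : ℝ) ≤ closedBlueCount G B u := Nat.one_le_cast.2 (one_le_closedBlueCount G hu)
  have hu' := subset_step G x B hu
  have hnonneg : 0 ≤ pathWeight G Δ w B u / 2 := by unfold pathWeight; positivity
  have hfactor : 0 ≤ 1 - 1 / (closedBlueCount G B u : ℝ) :=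
    sub_nonneg.2 ((div_le_one (by linarith)).2 hc)
  split_ifs with hforced
  · have hv' : v ∈ step G x B := (mem_step G).2 (Or.inr ⟨u, hu, huv, hforced⟩)
    have hdeg₀ : (0 : ℝ) < G.degree u :=
      Nat.cast_pos.2 ((G.degree_pos_iff_exists_adj u).2 ⟨v, huv⟩)
    rw [zero_mul, add_zero, ← ENNReal.ofReal_mul hnonneg]
    refine (pathPotential_le G hv').trans (ENNReal.ofReal_le_ofReal ?_)
    calc pathWeight G Δ w (step G x B) v ≤ (Δ : ℝ) ^ G.dist v w :=
          pathWeight_le_pow_dist G hu' hv' huv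
      _ = (Δ : ℝ) ^ G.dist v w * (G.degree u / G.degree u) := by
          rw [div_self hdeg₀.ne', mul_one]
      _ ≤ (Δ : ℝ) ^ G.dist v w * (Δ / G.degree u) := by gcongr
      _ = pathWeight G Δ w B u / 2 * forceProb G B u := by
          rw [pathWeight, hdist, forceProb, pow_succ]; field_simp
  · rw [prod_ite, prod_const, prod_const_one, mul_one, one_mul, ← ENNReal.ofReal_pow hfactor,
      ← ENNReal.ofReal_one, ← ENNReal.ofReal_add zero_le_one (pow_nonneg hfactor _),
      ← ENNReal.ofReal_mul hnonneg]
    exact (pathPotential_le G hu').trans (ENNReal.ofReal_le_ofReal (pathWeight_step_le hu hW x))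

theorem stepMean_pathPotential_le_pathWeight {Δ : ℕ} {w u v : V} {B : Finset V}
    (hdeg : G.degree u ≤ Δ) (hu : u ∈ B) (hv : v ∉ B) (huv : G.Adj u v)
    (hdist : G.dist u w = G.dist v w + 1) :
    stepMean G (pathPotential G Δ w) B ≤
      ENNReal.ofReal (3 / 4) * ENNReal.ofReal (pathWeight G Δ w B u) := by
  have hpe := forceProb_eq_one_sub G hu hv huv
  have hc : (1 : ℝ) ≤ closedBlueCount G B u := Nat.one_le_cast.2 (one_le_closedBlueCount G hu)
  have he : (1 : ℝ) ≤ G.degree u :=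
    Nat.one_le_cast.2 ((G.degree_pos_iff_exists_adj u).2 ⟨v, huv⟩)
  have hp₀ : 0 ≤ forceProb G B u := by unfold forceProb; positivity
  have hp₁ : forceProb G B u ≤ 1 := by rw [hpe]; exact sub_le_self _ (by positivity)
  have hfactor : 0 ≤ 1 - 1 / (closedBlueCount G B u : ℝ) :=
    sub_nonneg.2 ((div_le_one (by linarith)).2 hc)
  have hmean : (1 - 1 / (closedBlueCount G B u : ℝ)) * forceProb G B u + (1 - forceProb G B u) =
      1 - 1 / (G.degree u : ℝ) := by
    unfold forceProb; field_simp; ring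
  calc stepMean G (pathPotential G Δ w) B
      ≤ ENNReal.ofReal (pathWeight G Δ w B u / 2) * _ :=
        (lintegral_mono (pathPotential_step_le hdeg hu huv hdist (erase_subset v _))).trans_eq
          (lintegral_const_mul' _ _ ENNReal.ofReal_ne_top)
    _ ≤ ENNReal.ofReal (pathWeight G Δ w B u / 2) * ENNReal.ofReal (3 / 2) := by
        rw [lintegral_stepMeasure_forced_add_unforced u (notMem_erase v _) hp₀ hp₁ hfactor, hmean]
        gcongr
        exact mul_self_add_one_sub_add_mul_pow_le he hp₀ hpe
    _ = ENNReal.ofReal (3 / 4) * ENNReal.ofReal (pathWeight G Δ w B u) := by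
        rw [← ENNReal.ofReal_mul' (by norm_num), ← ENNReal.ofReal_mul (by norm_num)]
        ring_nf

theorem stepMean_pathPotential_le (hG : G.Connected) {Δ : ℕ} (hΔ : 2 ≤ Δ)
    (hdeg : ∀ u, G.degree u ≤ Δ) (w : V) {B : Finset V} (hB : B.Nonempty) :
    stepMean G (pathPotential G Δ w) B ≤ ENNReal.ofReal (3 / 4) * pathPotential G Δ w B := by
  by_cases hw : w ∈ B
  · have hstep (x : V × V → I) : pathPotential G Δ w (step G x B) = 0 :=
      if_pos (subset_step G x B hw)
    simp [stepMean, hstep]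
  obtain ⟨u, hu, hmin⟩ := exists_min_image B (pathWeight G Δ w B) hB
  obtain ⟨v, huv, hdist⟩ := exists_adj_dist_eq_add_one hG (ne_of_mem_of_not_mem hu hw)
  have hpotential : ENNReal.ofReal (pathWeight G Δ w B u) ≤ pathPotential G Δ w B := by
    rw [pathPotential, if_neg hw]
    exact le_iInf₂ fun y hy => ENNReal.ofReal_le_ofReal (hmin y hy)
  have hv := notMem_of_pathWeight_le hΔ (hdeg u) hu hmin huv hdist
  exact (stepMean_pathPotential_le_pathWeight (hdeg u) hu hv huv hdist).trans
    (mul_le_mul_right hpotential _)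

end Potential

section GeometricTail

theorem pow_mul_le_one_of_log_le {r M : ℝ} (hr : 0 < r) (hM : 0 < M) {T : ℕ}
    (hT : Real.log M ≤ (1 - r) * T) : r ^ T * M ≤ 1 := by
  rw [← Real.log_nonpos_iff (by positivity), Real.log_mul (by positivity) hM.ne', Real.log_pow]
  have hlog : (T : ℝ) * Real.log r ≤ T * (r - 1) :=
    mul_le_mul_of_nonneg_left (Real.log_le_sub_one_of_pos hr) T.cast_nonneg
  linarith

theorem tsum_ofReal_pow {r : ℝ} (hr₀ : 0 ≤ r) (hr₁ : r < 1) :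
    ∑' t : ℕ, ENNReal.ofReal (r ^ t) = ENNReal.ofReal (1 - r)⁻¹ := by
  rw [← tsum_geometric_of_lt_one hr₀ hr₁, ENNReal.ofReal_tsum_of_nonneg
    (fun t => pow_nonneg hr₀ t) (summable_geometric_of_lt_one hr₀ hr₁)]

theorem tsum_le_of_le_one_of_le_geometric {a : ℕ → ℝ≥0∞} {r M : ℝ} (hr₀ : 0 < r) (hr₁ : r < 1)
    (hM : 1 ≤ M) (ha₁ : ∀ t, a t ≤ 1) (ha : ∀ t, a t ≤ ENNReal.ofReal (r ^ t * M)) :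
    ∑' t, a t ≤ ENNReal.ofReal ((Real.log M + 1) / (1 - r) + 1) := by
  have hr : 0 < 1 - r := sub_pos.2 hr₁
  have hlog : 0 ≤ Real.log M / (1 - r) := div_nonneg (Real.log_nonneg hM) hr.le
  set T := ⌈Real.log M / (1 - r)⌉₊
  have hsmall : r ^ T * M ≤ 1 :=
    pow_mul_le_one_of_log_le hr₀ (by linarith) ((div_le_iff₀' hr).1 (Nat.le_ceil _))
  have hhead : ∑ t ∈ range T, a t ≤ ENNReal.ofReal T := by
    simpa using sum_le_card_nsmul (range T) a 1 fun t _ => ha₁ t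
  have htail : ∑' t, a (t + T) ≤ ENNReal.ofReal (1 - r)⁻¹ := by
    rw [← tsum_ofReal_pow hr₀.le hr₁]
    refine ENNReal.tsum_le_tsum fun t => (ha _).trans (ENNReal.ofReal_le_ofReal ?_)
    rw [pow_add, mul_assoc]
    exact mul_le_of_le_one_right (by positivity) hsmall
  calc ∑' t, a t = ∑ t ∈ range T, a t + ∑' t, a (t + T) :=
        (Summable.sum_add_tsum_nat_add' ENNReal.summable).symm
    _ ≤ ENNReal.ofReal T + ENNReal.ofReal (1 - r)⁻¹ := add_le_add hhead htail
    _ = ENNReal.ofReal (T + (1 - r)⁻¹) := (ENNReal.ofReal_add (by positivity) (by positivity)).symm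
    _ ≤ ENNReal.ofReal ((Real.log M + 1) / (1 - r) + 1) := by
        refine ENNReal.ofReal_le_ofReal ?_
        rw [add_div, one_div]
        linarith [Nat.ceil_lt_add_one hlog]

end GeometricTail

section Diameter

variable {V : Type*} {G : SimpleGraph V}

theorem exists_dist_eq_of_le (hG : G.Connected) (s w : V) {k : ℕ} (hk : k ≤ G.dist s w) :
    ∃ v, G.dist s v = k := by
  obtain ⟨p, hp⟩ := hG.exists_walk_length_eq_dist s w
  refine ⟨p.getVert k, ?_⟩
  have hinit := SimpleGraph.dist_le (p.take k)
  have hrest := SimpleGraph.dist_le (p.drop k)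
  have htriangle := hG.dist_triangle (u := s) (v := p.getVert k) (w := w)
  rw [SimpleGraph.Walk.take_length] at hinit
  rw [SimpleGraph.Walk.drop_length] at hrest
  omega

theorem dist_le_dist_add_one (hG : G.Connected) {s u v : V} (huv : G.Adj u v) :
    G.dist s v ≤ G.dist s u + 1 := by
  simpa [SimpleGraph.dist_eq_one_iff_adj.2 huv] using
    hG.dist_triangle (u := s) (v := u) (w := v)

/- Count pairs `(k, v)` with `k ≤ dist s w` and `dist s v` within `1` of `k`: the closed
neighbourhood of a vertex at distance `k` from `s` provides `δ + 1` of them for every `k`. -/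
theorem dist_add_one_mul_le [Fintype V] [DecidableRel G.Adj] (hG : G.Connected)
    {δ : ℕ} (hdeg : ∀ u, δ ≤ G.degree u) (s w : V) :
    (G.dist s w + 1) * (δ + 1) ≤ 3 * Fintype.card V := by
  classical
  let near (k : ℕ) (v : V) : Prop := k ≤ G.dist s v + 1 ∧ G.dist s v ≤ k + 1
  have hmany : ∀ k ∈ range (G.dist s w + 1), δ + 1 ≤ #(bipartiteAbove near univ k) := by
    intro k hk
    obtain ⟨v, hv⟩ := exists_dist_eq_of_le hG s w (mem_range_succ_iff.1 hk)
    calc δ + 1 ≤ #(insert v (G.neighborFinset v)) := by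
          rw [card_insert_of_notMem (by simp), G.card_neighborFinset_eq_degree]
          exact Nat.succ_le_succ (hdeg v)
      _ ≤ #(bipartiteAbove near univ k) := by
          refine card_le_card fun u hu => (mem_bipartiteAbove near).2 ⟨mem_univ u, ?_⟩
          rcases mem_insert.1 hu with rfl | hu
          · exact ⟨by omega, by omega⟩
          · have hvu := (G.mem_neighborFinset v u).1 hu
            have hu_le := dist_le_dist_add_one hG (s := s) hvu
            have hv_le := dist_le_dist_add_one hG (s := s) hvu.symm
            exact ⟨by omega, by omega⟩
  have hfew : ∀ v ∈ univ, #(bipartiteBelow near (range (G.dist s w + 1)) v) ≤ 3 := by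
    intro v _
    have hsub : bipartiteBelow near (range (G.dist s w + 1)) v ⊆
        Icc (G.dist s v - 1) (G.dist s v + 1) := fun k hk => by
      obtain ⟨-, hk₁, hk₂⟩ := (mem_bipartiteBelow near).1 hk
      exact mem_Icc.2 ⟨by omega, hk₁⟩
    exact (card_le_card hsub).trans (by rw [Nat.card_Icc]; omega)
  simpa [mul_comm] using card_mul_le_card_mul near hmany hfew

end Diameter

section LogBounds

theorem log_le_five_mul_log_add_one_div_three {x : ℝ} (hx : 3 ≤ x) :
    Real.log x ≤ 5 * Real.log ((x + 1) / 3) := by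
  have hpow : 5 * Real.log ((x + 1) / 3) = Real.log (((x + 1) / 3) ^ 5) := by
    rw [Real.log_pow, Nat.cast_ofNat]
  rw [hpow]
  refine Real.log_le_log (by linarith) ?_
  obtain ⟨y, rfl⟩ : ∃ y, x = 3 * y - 1 := ⟨(x + 1) / 3, by ring⟩
  have hy : 4 / 3 ≤ y := by linarith
  have hy₄ : (4 / 3) ^ 4 ≤ y ^ 4 := pow_le_pow_left₀ (by norm_num) hy 4
  calc 3 * y - 1 ≤ y ^ 4 * y := by nlinarith
    _ = ((3 * y - 1 + 1) / 3) ^ 5 := by ring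

theorem log_le_three_mul_div_mul_log {x y n : ℝ} (hx : 0 < x) (hxn : x ≤ n) (hxy : x ≤ y)
    (hy : 2 ≤ y) : Real.log n ≤ 3 * (n / x * Real.log y) := by
  have hlogy : Real.log 2 ≤ Real.log y := Real.log_le_log two_pos hy
  have hratio : 1 ≤ n / x := (one_le_div hx).2 hxn
  have hlog_ratio : Real.log (n / x) ≤ n / x - 1 := Real.log_le_sub_one_of_pos (by linarith)
  have hlog_mono : Real.log x ≤ Real.log y := Real.log_le_log hx hxy
  rw [Real.log_div (by linarith) hx.ne'] at hlog_ratio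
  nlinarith [Real.log_two_gt_d9]

end LogBounds

section UpperBound

variable {V : Type*} [Fintype V] [DecidableEq V] {G : SimpleGraph V} [DecidableRel G.Adj]

theorem sampleMeasure_notMem_blue_le (hG : G.Connected) {Δ L : ℕ} (hΔ : 2 ≤ Δ)
    (hdeg : ∀ u, G.degree u ≤ Δ) {s w : V} (hL : G.dist s w ≤ L) (t : ℕ) :
    sampleMeasure V {ω | w ∉ blue G {s} ω t} ≤
      ENNReal.ofReal ((3 / 4) ^ t * (2 * (Δ : ℝ) ^ L)) := by
  have hmeas : MeasurableSet {ω : Sample V | w ∉ blue G {s} ω t} :=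
    measurable_blue G {s} t (Set.toFinite {B | w ∉ B}).measurableSet
  calc sampleMeasure V {ω | w ∉ blue G {s} ω t}
      = ∫⁻ ω, {ω | w ∉ blue G {s} ω t}.indicator 1 ω ∂(sampleMeasure V) :=
        (lintegral_indicator_one hmeas).symm
    _ ≤ ∫⁻ ω, pathPotential G Δ w (blue G {s} ω t) ∂(sampleMeasure V) :=
        lintegral_mono <| Set.indicator_le fun ω hω =>
          one_le_pathPotential hG (one_le_two.trans hΔ) hdeg hω
    _ ≤ ENNReal.ofReal (3 / 4) ^ t * pathPotential G Δ w {s} :=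
        lintegral_blue_le_pow G (fun B hB =>
          stepMean_pathPotential_le hG hΔ hdeg w ⟨s, hB (mem_singleton_self s)⟩) t
    _ ≤ ENNReal.ofReal (3 / 4) ^ t * ENNReal.ofReal (2 * (Δ : ℝ) ^ L) := by
        gcongr
        exact pathPotential_singleton_le G (one_le_two.trans hΔ) hL
    _ = ENNReal.ofReal ((3 / 4) ^ t * (2 * (Δ : ℝ) ^ L)) := by
        rw [← ENNReal.ofReal_pow (by norm_num), ← ENNReal.ofReal_mul (by positivity)]

theorem sampleMeasure_blue_ne_univ_le (hG : G.Connected) {Δ L : ℕ} (hΔ : 2 ≤ Δ)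
    (hdeg : ∀ u, G.degree u ≤ Δ) {s : V} (hL : ∀ w, G.dist s w ≤ L) (t : ℕ) :
    sampleMeasure V {ω | blue G {s} ω t ≠ univ} ≤
      ENNReal.ofReal ((3 / 4) ^ t * (Fintype.card V * (2 * (Δ : ℝ) ^ L))) := by
  have hcover : {ω : Sample V | blue G {s} ω t ≠ univ} ⊆
      ⋃ w ∈ (univ : Finset V), {ω | w ∉ blue G {s} ω t} := fun ω hω => by
    simpa [eq_univ_iff_forall] using hω
  calc sampleMeasure V {ω | blue G {s} ω t ≠ univ}
      ≤ ∑ w : V, sampleMeasure V {ω | w ∉ blue G {s} ω t} :=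
        (measure_mono hcover).trans (measure_biUnion_finset_le _ _)
    _ ≤ ∑ _w : V, ENNReal.ofReal ((3 / 4) ^ t * (2 * (Δ : ℝ) ^ L)) :=
        sum_le_sum fun w _ => sampleMeasure_notMem_blue_le hG hΔ hdeg (hL w) t
    _ = ENNReal.ofReal ((3 / 4) ^ t * (Fintype.card V * (2 * (Δ : ℝ) ^ L))) := by
        rw [sum_const, card_univ, nsmul_eq_mul, ← ENNReal.ofReal_natCast,
          ← ENNReal.ofReal_mul (by positivity), mul_left_comm]

theorem eptFrom_le_of_dist_le (hG : G.Connected) {Δ L : ℕ} (hΔ : 2 ≤ Δ)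
    (hdeg : ∀ u, G.degree u ≤ Δ) {s : V} (hL : ∀ w, G.dist s w ≤ L) :
    eptFrom G {s} ≤
      ENNReal.ofReal (4 * (L * Real.log Δ) + (4 * Real.log (Fintype.card V) + 8)) := by
  have hn : (1 : ℝ) ≤ Fintype.card V := by exact_mod_cast Fintype.card_pos_iff.2 ⟨s⟩
  have hΔ' : (2 : ℝ) ≤ Δ := by exact_mod_cast hΔ
  have hpow : (1 : ℝ) ≤ 2 * (Δ : ℝ) ^ L := by
    linarith [one_le_pow₀ (n := L) (one_le_two.trans hΔ')]
  have hlog : Real.log (Fintype.card V * (2 * (Δ : ℝ) ^ L)) =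
      Real.log (Fintype.card V) + (Real.log 2 + L * Real.log Δ) := by
    rw [Real.log_mul (by positivity) (by positivity), Real.log_mul (by positivity) (by positivity),
      Real.log_pow]
  rw [eptFrom_eq_tsum]
  refine (tsum_le_of_le_one_of_le_geometric (by norm_num) (by norm_num)
    (one_le_mul_of_one_le_of_one_le hn hpow) (fun t => prob_le_one)
    (sampleMeasure_blue_ne_univ_le hG hΔ hdeg hL)).trans (ENNReal.ofReal_le_ofReal ?_)
  rw [hlog, show (1 : ℝ) - 3 / 4 = 4⁻¹ by norm_num, div_inv_eq_mul]
  linarith [Real.log_two_lt_d9]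

theorem eptFrom_le_add_log (hG : G.Connected) {δ Δ : ℕ} (hΔ : 2 ≤ Δ)
    (hδ : ∀ u, δ ≤ G.degree u) (hdeg : ∀ u, G.degree u ≤ Δ) (s : V) :
    eptFrom G {s} ≤ ENNReal.ofReal (12 * (Real.log Δ / (δ + 1)) * Fintype.card V +
      (4 * Real.log (Fintype.card V) + 8)) := by
  obtain ⟨w, -, hw⟩ := exists_max_image univ (G.dist s) ⟨s, mem_univ s⟩
  refine (eptFrom_le_of_dist_le hG hΔ hdeg fun v => hw v (mem_univ v)).trans
    (ENNReal.ofReal_le_ofReal ?_)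
  have hdist : ((G.dist s w : ℝ) + 1) * (δ + 1) ≤ 3 * Fintype.card V := by
    exact_mod_cast dist_add_one_mul_le hG hδ s w
  have hdist' : (G.dist s w : ℝ) ≤ 3 * Fintype.card V / (δ + 1) := by
    rw [le_div_iff₀ (by positivity)]
    nlinarith [Nat.cast_nonneg (α := ℝ) δ]
  have := Real.log_natCast_nonneg Δ
  calc 4 * (G.dist s w * Real.log Δ) + (4 * Real.log (Fintype.card V) + 8)
      ≤ 4 * (3 * Fintype.card V / (δ + 1) * Real.log Δ) +
          (4 * Real.log (Fintype.card V) + 8) := by gcongr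
    _ = 12 * (Real.log Δ / (δ + 1)) * Fintype.card V +
          (4 * Real.log (Fintype.card V) + 8) := by ring

theorem eptFrom_le_explicit (hG : G.Connected) {δ Δ : ℕ} (hδ : 1 ≤ δ) (hΔ : 3 ≤ Δ)
    (hmin : ∀ u, δ ≤ G.degree u) (hmax : ∀ u, G.degree u ≤ Δ) (s : V) :
    eptFrom G {s} ≤ ENNReal.ofReal (60 * (Real.log (((Δ : ℝ) + 1) / 3) / ((δ : ℝ) + 1)) *
      Fintype.card V + 16 * Real.log (Fintype.card V)) := by
  refine (eptFrom_le_add_log hG (by omega) hmin hmax s).trans (ENNReal.ofReal_le_ofReal ?_)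
  have hn : (2 : ℝ) ≤ Fintype.card V := by
    exact_mod_cast (hδ.trans (hmin s)).trans_lt (G.degree_lt_card_verts s)
  have hlogn : Real.log 2 ≤ Real.log (Fintype.card V) := Real.log_le_log two_pos hn
  have hlogΔ := log_le_five_mul_log_add_one_div_three (x := Δ) (by exact_mod_cast hΔ)
  have hmain : 12 * (Real.log Δ / (δ + 1)) * Fintype.card V ≤
      60 * (Real.log (((Δ : ℝ) + 1) / 3) / (δ + 1)) * Fintype.card V := by
    calc 12 * (Real.log Δ / (δ + 1)) * Fintype.card V
        ≤ 12 * (5 * Real.log (((Δ : ℝ) + 1) / 3) / (δ + 1)) * Fintype.card V := by gcongr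
      _ = 60 * (Real.log (((Δ : ℝ) + 1) / 3) / (δ + 1)) * Fintype.card V := by ring
  linarith [Real.log_two_gt_d9]

theorem eptFrom_le_const_mul (hG : G.Connected) {δ Δ : ℕ} (hδ : 1 ≤ δ) (hΔ : 2 ≤ Δ)
    (hmin : ∀ u, δ ≤ G.degree u) (hmax : ∀ u, G.degree u ≤ Δ) (s : V) :
    eptFrom G {s} ≤ ENNReal.ofReal (40 * (Fintype.card V * (Real.log Δ / δ))) := by
  refine (eptFrom_le_add_log hG hΔ hmin hmax s).trans (ENNReal.ofReal_le_ofReal ?_)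
  have hδ' : (1 : ℝ) ≤ δ := by exact_mod_cast hδ
  have hΔ' : (2 : ℝ) ≤ Δ := by exact_mod_cast hΔ
  have hδΔ : (δ : ℝ) ≤ Δ := by exact_mod_cast (hmin s).trans (hmax s)
  have hδn : (δ : ℝ) ≤ Fintype.card V := by
    exact_mod_cast (hmin s).trans (G.degree_lt_card_verts s).le
  have hlogΔ : Real.log 2 ≤ Real.log Δ := Real.log_le_log two_pos hΔ'
  have hmain : Real.log Δ / (δ + 1) * Fintype.card V ≤ Fintype.card V / δ * Real.log Δ := by
    calc Real.log Δ / (δ + 1) * Fintype.card V ≤ Real.log Δ / δ * Fintype.card V := by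
          have := Real.log_natCast_nonneg Δ
          gcongr
          linarith
      _ = Fintype.card V / δ * Real.log Δ := by ring
  have hlogn := log_le_three_mul_div_mul_log (by linarith) hδn hδΔ hΔ'
  have hconst : Real.log 2 ≤ Fintype.card V / δ * Real.log Δ :=
    hlogΔ.trans (le_mul_of_one_le_left (Real.log_natCast_nonneg Δ)
      ((one_le_div (by linarith)).2 hδn))
  have hcomm : Fintype.card V * (Real.log Δ / δ) = Fintype.card V / δ * Real.log Δ := by ring
  linarith [Real.log_two_gt_d9]

end UpperBound

section GrowthScale

/-- The doubly logarithmic scale on which the number of blue vertices in the front layer is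
measured: squaring `b` and multiplying it by a constant raises it by a bounded amount only. The
summand `1` makes it vanish at `b = 1`. -/
noncomputable def growthScale (b : ℝ) : ℝ := Real.log (1 + Real.log b)

theorem growthScale_one : growthScale 1 = 0 := by simp [growthScale]

theorem growthScale_le_growthScale {b b' : ℝ} (hb : 1 ≤ b) (hbb' : b ≤ b') :
    growthScale b ≤ growthScale b' :=
  Real.log_le_log (by linarith [Real.log_nonneg hb]) <| by gcongr

theorem growthScale_nonneg {b : ℝ} (hb : 1 ≤ b) : 0 ≤ growthScale b :=
  Real.log_nonneg (by linarith [Real.log_nonneg hb])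

theorem growthScale_four_le_one : growthScale 4 ≤ 1 := by
  have hlog : Real.log 4 = 2 * Real.log 2 := by
    rw [show (4 : ℝ) = 2 ^ 2 by norm_num, Real.log_pow, Nat.cast_ofNat]
  rw [growthScale, hlog, Real.log_le_iff_le_exp (by linarith [Real.log_two_gt_d9])]
  linarith [Real.log_two_lt_d9, Real.exp_one_gt_d9]

theorem log_le_one_add_div_seven {x : ℝ} (hx : 0 < x) : Real.log x ≤ 1 + x / 7 := by
  have hexp : 7 ≤ Real.exp 2 := by
    have hsq : Real.exp 2 = Real.exp 1 ^ 2 := by rw [← Real.exp_nat_mul, mul_one, Nat.cast_ofNat]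
    nlinarith [Real.exp_one_gt_d9]
  have hlog7 : Real.log 7 ≤ 2 := (Real.log_le_iff_le_exp (by norm_num)).2 hexp
  have hlog := Real.log_le_sub_one_of_pos (show 0 < x / 7 by positivity)
  rw [Real.log_div hx.ne' (by norm_num)] at hlog
  linarith

theorem growthScale_le_add {b b' : ℝ} (hb : 1 ≤ b) (hb' : 1 ≤ b') :
    growthScale b' ≤ growthScale b + 1 + b' / (7 * b ^ 2) := by
  obtain ⟨x, rfl⟩ : ∃ x, b' = b ^ 2 * x := ⟨b' / b ^ 2, by field_simp⟩
  have hx : 0 < x := pos_of_mul_pos_right (by linarith) (sq_nonneg b)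
  have hz : 1 ≤ 1 + Real.log b := by linarith [Real.log_nonneg hb]
  have hz' : 0 < 1 + Real.log (b ^ 2 * x) := by linarith [Real.log_nonneg hb']
  have hfactor : 1 + Real.log (b ^ 2 * x) ≤ 2 * (1 + Real.log b) * (1 + x / 7) := by
    rw [Real.log_mul (by positivity) hx.ne', Real.log_pow, Nat.cast_ofNat]
    nlinarith [log_le_one_add_div_seven hx]
  have hlog : Real.log (1 + x / 7) ≤ x / 7 := by
    linarith [Real.log_le_sub_one_of_pos (show 0 < 1 + x / 7 by positivity)]
  calc growthScale (b ^ 2 * x) ≤ Real.log (2 * (1 + Real.log b) * (1 + x / 7)) :=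
        Real.log_le_log hz' hfactor
    _ = Real.log 2 + growthScale b + Real.log (1 + x / 7) := by
        rw [Real.log_mul (by positivity) (by positivity), Real.log_mul two_ne_zero (by positivity),
          growthScale]
    _ ≤ growthScale b + 1 + b ^ 2 * x / (7 * b ^ 2) := by
        rw [mul_comm 7, mul_div_mul_left _ _ (by positivity)]
        linarith [Real.log_two_lt_d9]

/-- The contribution to the layer potential of a layer that the front has crossed, when degrees are
at least `d`. -/
noncomputable def layerHeight (d : ℕ) : ℝ := growthScale (d + 1) / 2

theorem layerHeight_nonneg (d : ℕ) : 0 ≤ layerHeight d :=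
  div_nonneg (growthScale_nonneg (by simp)) zero_le_two

theorem layerHeight_le_sqrt (d : ℕ) : layerHeight d ≤ √((d : ℝ) + 1) := by
  have hd : (0 : ℝ) < d + 1 := by positivity
  have hlog : 0 ≤ Real.log ((d : ℝ) + 1) := Real.log_nonneg (by simp)
  have houter : growthScale (d + 1) ≤ Real.log ((d : ℝ) + 1) :=
    (Real.log_le_sub_one_of_pos (by linarith)).trans_eq (add_sub_cancel_left _ _)
  have hinner := Real.log_le_sub_one_of_pos (Real.sqrt_pos.2 hd)
  rw [Real.log_sqrt hd.le] at hinner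
  rw [layerHeight]
  linarith

theorem log_log_le_two_mul_layerHeight {d : ℕ} (hd : 2 ≤ d) :
    Real.log (Real.log d) ≤ 2 * layerHeight d := by
  have hd' : (1 : ℝ) < d := by exact_mod_cast hd
  have hlog : Real.log d ≤ Real.log (d + 1) := Real.log_le_log (by linarith) (by linarith)
  rw [layerHeight, mul_div_cancel₀ _ two_ne_zero]
  exact Real.log_le_log (Real.log_pos hd') (by linarith)

theorem sq_le_of_growthScale_le {b : ℝ} {d : ℕ} (hb : 1 ≤ b)
    (h : growthScale b ≤ layerHeight d) : b ^ 2 ≤ d + 1 := by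
  have hlogb := Real.log_nonneg hb
  have hlogd : 0 ≤ Real.log ((d : ℝ) + 1) := Real.log_nonneg (by simp)
  have hsq : (1 + Real.log b) ^ 2 ≤ 1 + Real.log (d + 1) := by
    rw [layerHeight, le_div_iff₀ two_pos, growthScale, growthScale, mul_comm] at h
    rwa [← Real.log_le_log_iff (by positivity) (by positivity), Real.log_pow, Nat.cast_ofNat]
  rw [← Real.log_le_log_iff (by positivity) (by positivity), Real.log_pow, Nat.cast_ofNat]
  nlinarith

theorem layerHeight_sub_min_mul_le {b : ℝ} {d : ℕ} (hb : 1 ≤ b) (hd : 1 ≤ d) :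
    (layerHeight d - min (layerHeight d) (growthScale b)) * (4 * ((b + 1) / d)) ≤ 16 := by
  rcases le_total (layerHeight d) (growthScale b) with h | h
  · simp [h]
  have hd' : (1 : ℝ) ≤ d := by exact_mod_cast hd
  have hs : √((d : ℝ) + 1) * √((d : ℝ) + 1) = d + 1 := Real.mul_self_sqrt (by positivity)
  have hs₁ : 1 ≤ √((d : ℝ) + 1) := Real.one_le_sqrt.2 (by linarith)
  have hheight : layerHeight d - growthScale b ≤ √((d : ℝ) + 1) := by
    linarith [layerHeight_le_sqrt d, growthScale_nonneg hb]
  have hbs : b ≤ √((d : ℝ) + 1) := Real.le_sqrt_of_sq_le (sq_le_of_growthScale_le hb h)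
  rw [min_eq_right h]
  calc (layerHeight d - growthScale b) * (4 * ((b + 1) / d))
      ≤ √((d : ℝ) + 1) * (4 * ((√((d : ℝ) + 1) + √((d : ℝ) + 1)) / d)) := by gcongr
    _ = 8 * (√((d : ℝ) + 1) * √((d : ℝ) + 1)) / d := by ring
    _ ≤ 16 := by
        rw [hs, div_le_iff₀ (by positivity)]
        linarith

end GrowthScale

section ForcedPairs

variable {V : Type*} [Fintype V] [DecidableEq V] (G : SimpleGraph V) [DecidableRel G.Adj]

/-- The pairs `(u, v)` of `E` along which `u` forces `v` in one step from `B`, when the randomness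
of the step is `x`. Adjacency and the colours of `u` and `v` are left to the choice of `E`. -/
noncomputable def forcedPairs (E : Finset (V × V)) (x : V × V → I) (B : Finset V) :
    Finset (V × V) :=
  {e ∈ E | (x e : ℝ) ≤ forceProb G B e.1}

theorem forceProb_nonneg (B : Finset V) (u : V) : 0 ≤ forceProb G B u := by
  unfold forceProb
  positivity

theorem lintegral_sum_forcedPairs_le (B : Finset V) (E : Finset (V × V)) {κ : V × V → ℝ}
    (hκ : ∀ e ∈ E, 0 ≤ κ e) :
    ∫⁻ x, ENNReal.ofReal (∑ e ∈ forcedPairs G E x B, κ e) ∂(stepMeasure V) ≤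
      ENNReal.ofReal (∑ e ∈ E, κ e * forceProb G B e.1) := by
  have hmeas (e : V × V) : MeasurableSet {x : V × V → I | (x e : ℝ) ≤ forceProb G B e.1} :=
    measurableSet_le (by fun_prop) measurable_const
  have hsum (x : V × V → I) : ENNReal.ofReal (∑ e ∈ forcedPairs G E x B, κ e) =
      ∑ e ∈ E, {x : V × V → I | (x e : ℝ) ≤ forceProb G B e.1}.indicator
        (fun _ => ENNReal.ofReal (κ e)) x := by
    rw [forcedPairs, ENNReal.ofReal_sum_of_nonneg fun e he => hκ e (mem_filter.1 he).1, sum_filter]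
    rfl
  calc ∫⁻ x, ENNReal.ofReal (∑ e ∈ forcedPairs G E x B, κ e) ∂(stepMeasure V)
      = ∑ e ∈ E, ENNReal.ofReal (κ e) *
          stepMeasure V {x : V × V → I | (x e : ℝ) ≤ forceProb G B e.1} := by
        simp_rw [hsum]
        rw [lintegral_finsetSum _ fun e _ => measurable_const.indicator (hmeas e)]
        simp_rw [lintegral_indicator_const (hmeas _)]
    _ ≤ ∑ e ∈ E, ENNReal.ofReal (κ e) * ENNReal.ofReal (forceProb G B e.1) :=
        sum_le_sum fun e _ => mul_le_mul_right (stepMeasure_forced_le _ e) _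
    _ = ENNReal.ofReal (∑ e ∈ E, κ e * forceProb G B e.1) := by
        rw [ENNReal.ofReal_sum_of_nonneg fun e he =>
          mul_nonneg (hκ e he) (forceProb_nonneg G B e.1)]
        exact sum_congr rfl fun e he => (ENNReal.ofReal_mul (hκ e he)).symm

theorem stepMean_ofReal_le {Φ : Finset V → ℝ} {A : ℝ} {B : Finset V} {E : Finset (V × V)}
    {κ : V × V → ℝ} (hA : 0 ≤ A) (hκ : ∀ e ∈ E, 0 ≤ κ e)
    (hΦ : ∀ x, Φ (step G x B) ≤ A + ∑ e ∈ forcedPairs G E x B, κ e) :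
    stepMean G (fun B => ENNReal.ofReal (Φ B)) B ≤
      ENNReal.ofReal (A + ∑ e ∈ E, κ e * forceProb G B e.1) := by
  have hsum : 0 ≤ ∑ e ∈ E, κ e * forceProb G B e.1 :=
    sum_nonneg fun e he => mul_nonneg (hκ e he) (forceProb_nonneg G B e.1)
  calc stepMean G (fun B => ENNReal.ofReal (Φ B)) B
      ≤ ∫⁻ x, (ENNReal.ofReal A + ENNReal.ofReal (∑ e ∈ forcedPairs G E x B, κ e))
          ∂(stepMeasure V) :=
        lintegral_mono fun x =>
          (ENNReal.ofReal_le_ofReal (hΦ x)).trans ENNReal.ofReal_add_le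
    _ = ENNReal.ofReal A +
          ∫⁻ x, ENNReal.ofReal (∑ e ∈ forcedPairs G E x B, κ e) ∂(stepMeasure V) := by
        rw [lintegral_add_left measurable_const, lintegral_const, measure_univ, mul_one]
    _ ≤ ENNReal.ofReal A + ENNReal.ofReal (∑ e ∈ E, κ e * forceProb G B e.1) := by
        gcongr
        exact lintegral_sum_forcedPairs_le G B E hκ
    _ = ENNReal.ofReal (A + ∑ e ∈ E, κ e * forceProb G B e.1) := (ENNReal.ofReal_add hA hsum).symm

end ForcedPairs

section LayerCount

variable {V : Type*} {l : V → ℕ}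

/-- The number of blue vertices in the layer `k`. -/
def layerCount (l : V → ℕ) (B : Finset V) (k : ℕ) : ℕ := #{v ∈ B | l v = k}

/-- A potential that measures how far the blue set has advanced, by the index of the front layer
(the last one that it meets) and by the number of its vertices there. The cap `K` makes an advance
of the front worth at least as much as any number of blue vertices in the front layer. -/
noncomputable def layerPotential (l : V → ℕ) (K : ℝ) (B : Finset V) : ℝ :=
  K * (B.sup l : ℕ) + min K (growthScale (layerCount l B (B.sup l)))

theorem one_le_layerCount_sup {B : Finset V} (hB : B.Nonempty) :
    1 ≤ layerCount l B (B.sup l) := by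
  obtain ⟨v, hv, hsup⟩ := exists_mem_eq_sup B hB l
  exact one_le_card.2 ⟨v, by simp [hv, hsup]⟩

theorem layerPotential_nonneg {K : ℝ} (hK : 0 ≤ K) (l : V → ℕ) {B : Finset V}
    (hB : B.Nonempty) : 0 ≤ layerPotential l K B := by
  have hcount : (1 : ℝ) ≤ layerCount l B (B.sup l) := by exact_mod_cast one_le_layerCount_sup hB
  have := growthScale_nonneg hcount
  unfold layerPotential
  positivity

theorem layerPotential_singleton_eq_zero {K : ℝ} (hK : 0 ≤ K) {s : V} (hs : l s = 0) :
    layerPotential l K {s} = 0 := by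
  have hcount : layerCount l {s} 0 = 1 := by simp [layerCount, filter_singleton, hs]
  simp [layerPotential, hs, hcount, growthScale_one, hK]

theorem layerHeight_mul_le_layerPotential_univ [Fintype V] {d M : ℕ} (hM : ∀ v, l v ≤ M)
    (hcount : d + 1 ≤ #{v | l v = M}) :
    layerHeight d * (M + 1) ≤ layerPotential l (layerHeight d) univ := by
  obtain ⟨v, hv⟩ := card_pos.1 (d.succ_pos.trans_le hcount)
  have hsup : (univ : Finset V).sup l = M :=
    le_antisymm (Finset.sup_le fun v _ => hM v)
      ((mem_filter.1 hv).2.symm.le.trans (le_sup (f := l) (mem_univ v)))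
  have hgrowth : growthScale (d + 1) ≤ growthScale (layerCount l univ M) :=
    growthScale_le_growthScale (by simp) (by exact_mod_cast hcount)
  have hcap : layerHeight d ≤ growthScale (layerCount l univ M) :=
    (half_le_self (growthScale_nonneg (by simp))).trans hgrowth
  rw [layerPotential, hsup, min_eq_left hcap]
  linarith

/-- A bound for what forcing along the front pair `e` adds to the layer potential: a share of the
growth of the front layer and, if `e` leads to the next layer, what is missing to the cap `K`. -/
noncomputable def frontGain (l : V → ℕ) (K : ℝ) (B : Finset V) (e : V × V) : ℝ :=
  1 / (7 * (layerCount l B (B.sup l) : ℝ) ^ 2) +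
    if l e.2 = B.sup l + 1 then K - min K (growthScale (layerCount l B (B.sup l))) else 0

theorem frontGain_nonneg (l : V → ℕ) (K : ℝ) (B : Finset V) (e : V × V) :
    0 ≤ frontGain l K B e := by
  have : 0 ≤ K - min K (growthScale (layerCount l B (B.sup l))) := sub_nonneg.2 (min_le_left _ _)
  unfold frontGain
  positivity

end LayerCount

section Layers

variable {V : Type*} [Fintype V] {G : SimpleGraph V} [DecidableRel G.Adj] {l : V → ℕ}

/-- A partition of the vertices into the level sets of `l`, called layers, with few edges between
them: a layer is joined to at most the two next to it, by at most four edges to the next one, and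
every vertex has at most one neighbour outside its layer. -/
structure IsLayering (G : SimpleGraph V) [DecidableRel G.Adj] (l : V → ℕ) : Prop where
  le_add_one : ∀ {u v}, G.Adj u v → l v ≤ l u + 1
  card_outside_le : ∀ u, #{v | G.Adj u v ∧ l v ≠ l u} ≤ 1
  card_cut_le : ∀ k, #{e : V × V | G.Adj e.1 e.2 ∧ l e.1 = k ∧ l e.2 = k + 1} ≤ 4

theorem IsLayering.card_cut_into_le (hl : IsLayering G l) (k : ℕ) :
    #{e : V × V | G.Adj e.1 e.2 ∧ l e.1 < k ∧ l e.2 = k} ≤ 4 := by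
  rcases k with - | k
  · simp
  · refine (card_le_card fun e he => ?_).trans (hl.card_cut_le k)
    simp only [mem_filter, mem_univ, true_and] at he ⊢
    have := hl.le_add_one he.1
    exact ⟨he.1, by omega, he.2.2⟩

variable [DecidableEq V]

variable (G) in
/-- The ordered pairs of a blue vertex of the front layer and one of its neighbours. -/
def frontPairs (l : V → ℕ) (B : Finset V) : Finset (V × V) :=
  {e | G.Adj e.1 e.2 ∧ e.1 ∈ B ∧ l e.1 = B.sup l}

variable (G) in
/-- The pairs along which the front can advance by a layer. -/
def advancingPairs (l : V → ℕ) (B : Finset V) : Finset (V × V) :=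
  {e ∈ frontPairs G l B | l e.2 = B.sup l + 1}

theorem mem_frontPairs {B : Finset V} {e : V × V} :
    e ∈ frontPairs G l B ↔ G.Adj e.1 e.2 ∧ e.1 ∈ B ∧ l e.1 = B.sup l := by
  simp [frontPairs]

theorem mem_forcedPairs_advancingPairs {x : V × V → I} {B : Finset V} {u v : V} :
    (u, v) ∈ forcedPairs G (advancingPairs G l B) x B ↔
      (G.Adj u v ∧ u ∈ B ∧ l u = B.sup l) ∧ l v = B.sup l + 1 ∧
        (x (u, v) : ℝ) ≤ forceProb G B u := by
  simp [forcedPairs, advancingPairs, mem_frontPairs, and_assoc]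

theorem IsLayering.exists_forced_of_sup_lt (hl : IsLayering G l) {x : V × V → I} {B : Finset V}
    {v : V} (hv : v ∈ step G x B) (hlt : B.sup l < l v) :
    ∃ u, (u, v) ∈ forcedPairs G (advancingPairs G l B) x B := by
  rcases (mem_step G).1 hv with hvB | ⟨u, hu, huv, hx⟩
  · exact absurd (le_sup (f := l) hvB) hlt.not_ge
  · have hu_le : l u ≤ B.sup l := le_sup hu
    have hv_le := hl.le_add_one huv
    exact ⟨u, mem_forcedPairs_advancingPairs.2 ⟨⟨huv, hu, by omega⟩, by omega, hx⟩⟩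

theorem IsLayering.sup_step_of_lt (hl : IsLayering G l) {x : V × V → I} {B : Finset V}
    (hlt : B.sup l < (step G x B).sup l) : (step G x B).sup l = B.sup l + 1 := by
  refine le_antisymm (Finset.sup_le fun v hv => ?_) hlt
  by_contra! hv_lt
  obtain ⟨u, hu⟩ := hl.exists_forced_of_sup_lt hv (by omega)
  have hv_eq := (mem_forcedPairs_advancingPairs.1 hu).2.1
  omega

theorem IsLayering.one_le_card_forcedPairs (hl : IsLayering G l) {x : V × V → I} {B : Finset V}
    (hlt : B.sup l < (step G x B).sup l) :
    1 ≤ #(forcedPairs G (advancingPairs G l B) x B) := by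
  obtain ⟨v, hv, hv_lt⟩ := Finset.lt_sup_iff.1 hlt
  obtain ⟨u, hu⟩ := hl.exists_forced_of_sup_lt hv hv_lt
  exact one_le_card.2 ⟨_, hu⟩

theorem IsLayering.layerCount_step_add_one_le (hl : IsLayering G l) (x : V × V → I)
    (B : Finset V) : layerCount l (step G x B) (B.sup l + 1) ≤ 4 := by
  refine (card_le_card fun v hv => ?_).trans
    ((card_image_le (f := Prod.snd)).trans (hl.card_cut_le (B.sup l)))
  obtain ⟨hv, hvl⟩ := mem_filter.1 hv
  obtain ⟨u, hu⟩ := hl.exists_forced_of_sup_lt hv (by omega)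
  obtain ⟨⟨huv, -, hul⟩, -, -⟩ := mem_forcedPairs_advancingPairs.1 hu
  exact mem_image.2 ⟨(u, v), by simp [huv, hul, hvl], rfl⟩

theorem IsLayering.layerCount_step_le (hl : IsLayering G l) (x : V × V → I) (B : Finset V) :
    layerCount l (step G x B) (B.sup l) ≤ layerCount l B (B.sup l) + 4 +
      #(forcedPairs G (frontPairs G l B) x B) := by
  let old : Finset V := {v ∈ B | l v = B.sup l}
  let behind : Finset (V × V) := {e | G.Adj e.1 e.2 ∧ l e.1 < B.sup l ∧ l e.2 = B.sup l}
  let forced := forcedPairs G (frontPairs G l B) x B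
  have hsub : {v ∈ step G x B | l v = B.sup l} ⊆
      old ∪ behind.image Prod.snd ∪ forced.image Prod.snd := by
    intro v hv
    obtain ⟨hv, hvl⟩ := mem_filter.1 hv
    rcases (mem_step G).1 hv with hvB | ⟨u, hu, huv, hx⟩
    · exact mem_union_left _ (mem_union_left _ (mem_filter.2 ⟨hvB, hvl⟩))
    · rcases (le_sup (f := l) hu).lt_or_eq with hul | hul
      · exact mem_union_left _ (mem_union_right _
          (mem_image.2 ⟨(u, v), mem_filter.2 ⟨mem_univ _, huv, hul, hvl⟩, rfl⟩))
      · exact mem_union_right _ (mem_image.2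
          ⟨(u, v), mem_filter.2 ⟨mem_frontPairs.2 ⟨huv, hu, hul⟩, hx⟩, rfl⟩)
  calc layerCount l (step G x B) (B.sup l)
      ≤ #old + #(behind.image Prod.snd) + #(forced.image Prod.snd) :=
        (card_le_card hsub).trans <|
          (card_union_le _ _).trans (Nat.add_le_add_right (card_union_le _ _) _)
    _ ≤ #old + 4 + #forced := by
        gcongr
        · exact card_image_le.trans (hl.card_cut_into_le _)
        · exact card_image_le

end Layers

section FrontAdvance

variable {V : Type*} [Fintype V] [DecidableEq V] {G : SimpleGraph V} [DecidableRel G.Adj]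
  {l : V → ℕ}

theorem layerPotential_step_le_of_sup_eq (K : ℝ) {x : V × V → I} {B : Finset V}
    (hB : B.Nonempty) (hsup : (step G x B).sup l = B.sup l) :
    layerPotential l K (step G x B) ≤ layerPotential l K B + 1 +
      layerCount l (step G x B) (B.sup l) / (7 * (layerCount l B (B.sup l) : ℝ) ^ 2) := by
  rw [layerPotential, layerPotential, hsup]
  set b : ℝ := (layerCount l B (B.sup l) : ℝ) with hb
  set b' : ℝ := (layerCount l (step G x B) (B.sup l) : ℝ) with hb'
  have hb₁ : 1 ≤ b := by rw [hb]; exact_mod_cast one_le_layerCount_sup hB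
  have hbb' : b ≤ b' := by
    rw [hb, hb']
    exact_mod_cast card_le_card (filter_subset_filter _ (subset_step G x B))
  have hgrowth := growthScale_le_add hb₁ (hb₁.trans hbb')
  have hmin : min K (growthScale b') ≤ min K (growthScale b) + (1 + b' / (7 * b ^ 2)) := by
    have : 0 ≤ b' / (7 * b ^ 2) := by positivity
    rw [← min_add_add_right]
    exact min_le_min (by linarith) (by linarith)
  linarith

theorem IsLayering.layerPotential_step_le_of_sup_lt (hl : IsLayering G l) (K : ℝ)
    {x : V × V → I} {B : Finset V} (hB : B.Nonempty) (hsup : B.sup l < (step G x B).sup l) :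
    layerPotential l K (step G x B) ≤ layerPotential l K B + 1 +
      (K - min K (growthScale (layerCount l B (B.sup l)))) := by
  have hsup' := hl.sup_step_of_lt hsup
  have hone := one_le_layerCount_sup (l := l) (hB.mono (subset_step G x B))
  rw [hsup'] at hone
  have hgrowth : growthScale (layerCount l (step G x B) (B.sup l + 1)) ≤ 1 :=
    (growthScale_le_growthScale (by exact_mod_cast hone)
      (by exact_mod_cast hl.layerCount_step_add_one_le x B)).trans growthScale_four_le_one
  rw [layerPotential, layerPotential, hsup', Nat.cast_add, Nat.cast_one]
  linarith [min_le_right K (growthScale (layerCount l (step G x B) (B.sup l + 1)))]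

theorem sum_forcedPairs_frontGain (l : V → ℕ) (K : ℝ) (x : V × V → I) (B : Finset V) :
    ∑ e ∈ forcedPairs G (frontPairs G l B) x B, frontGain l K B e =
      #(forcedPairs G (frontPairs G l B) x B) / (7 * (layerCount l B (B.sup l) : ℝ) ^ 2) +
        #(forcedPairs G (advancingPairs G l B) x B) *
          (K - min K (growthScale (layerCount l B (B.sup l)))) := by
  have hfilter : {e ∈ forcedPairs G (frontPairs G l B) x B | l e.2 = B.sup l + 1} =
      forcedPairs G (advancingPairs G l B) x B := filter_comm _ _ _
  simp only [frontGain, sum_add_distrib, sum_const, ← sum_filter, hfilter, nsmul_eq_mul,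
    mul_one_div]

theorem IsLayering.layerPotential_step_le (hl : IsLayering G l) (K : ℝ) (x : V × V → I)
    {B : Finset V} (hB : B.Nonempty) :
    layerPotential l K (step G x B) ≤ layerPotential l K B + 1 +
      (layerCount l B (B.sup l) + 4) / (7 * (layerCount l B (B.sup l) : ℝ) ^ 2) +
      ∑ e ∈ forcedPairs G (frontPairs G l B) x B, frontGain l K B e := by
  have hgap : 0 ≤ K - min K (growthScale (layerCount l B (B.sup l))) :=
    sub_nonneg.2 (min_le_left _ _)
  rw [sum_forcedPairs_frontGain]
  rcases (sup_mono (f := l) (subset_step G x B)).eq_or_lt with hsup | hsup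
  · have hcount : (layerCount l (step G x B) (B.sup l) : ℝ) ≤
        layerCount l B (B.sup l) + 4 + #(forcedPairs G (frontPairs G l B) x B) := by
      exact_mod_cast hl.layerCount_step_le x B
    have hdiv := div_le_div_of_nonneg_right hcount
      (show 0 ≤ 7 * (layerCount l B (B.sup l) : ℝ) ^ 2 by positivity)
    rw [add_div _ (#(forcedPairs G (frontPairs G l B) x B) : ℝ)] at hdiv
    have hadvance := mul_nonneg (#(forcedPairs G (advancingPairs G l B) x B)).cast_nonneg hgap
    linarith [layerPotential_step_le_of_sup_eq K hB hsup.symm]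
  · have hforced : (1 : ℝ) ≤ #(forcedPairs G (advancingPairs G l B) x B) := by
      exact_mod_cast hl.one_le_card_forcedPairs hsup
    have hadvance := le_mul_of_one_le_left hgap hforced
    have hshare : 0 ≤ (layerCount l B (B.sup l) + 4) / (7 * (layerCount l B (B.sup l) : ℝ) ^ 2) +
        #(forcedPairs G (frontPairs G l B) x B) / (7 * (layerCount l B (B.sup l) : ℝ) ^ 2) := by
      positivity
    linarith [hl.layerPotential_step_le_of_sup_lt K hB hsup]

theorem IsLayering.closedBlueCount_le (hl : IsLayering G l) {B : Finset V} {u : V}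
    (hu : u ∈ B) : closedBlueCount G B u ≤ layerCount l B (l u) + 1 := by
  have hsub : B ∩ G.neighborFinset u ⊆
      ({v ∈ B | l v = l u} : Finset V).erase u ∪ ({v | G.Adj u v ∧ l v ≠ l u} : Finset V) := by
    intro v hv
    obtain ⟨hvB, huv⟩ := mem_inter.1 hv
    rw [SimpleGraph.mem_neighborFinset] at huv
    by_cases hvl : l v = l u <;> simp [hvB, huv, huv.ne', hvl]
  calc closedBlueCount G B u = #(B ∩ G.neighborFinset u) + 1 := closedBlueCount_of_mem G hu
    _ ≤ #(({v ∈ B | l v = l u} : Finset V).erase u) + 1 + 1 := by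
        gcongr
        exact (card_le_card hsub).trans ((card_union_le _ _).trans
          (Nat.add_le_add_left (hl.card_outside_le u) _))
    _ = layerCount l B (l u) + 1 := by
        rw [card_erase_add_one (s := {v ∈ B | l v = l u}) (by simp [hu]), layerCount]

theorem IsLayering.sum_frontPairs_forceProb_le (hl : IsLayering G l) (B : Finset V) :
    ∑ e ∈ frontPairs G l B, forceProb G B e.1 ≤
      (layerCount l B (B.sup l) : ℝ) * (layerCount l B (B.sup l) + 1) := by
  have hvertex : ∀ u ∈ ({u ∈ B | l u = B.sup l} : Finset V),
      ∑ _v ∈ G.neighborFinset u, forceProb G B u ≤ (layerCount l B (B.sup l) : ℝ) + 1 := by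
    intro u hu
    obtain ⟨huB, hul⟩ := mem_filter.1 hu
    have hcount : (closedBlueCount G B u : ℝ) ≤ layerCount l B (B.sup l) + 1 := by
      exact_mod_cast hul ▸ hl.closedBlueCount_le huB
    rw [sum_const, G.card_neighborFinset_eq_degree, nsmul_eq_mul, forceProb, mul_div_left_comm]
    exact (mul_le_of_le_one_right (Nat.cast_nonneg _) (div_self_le_one _)).trans hcount
  rw [sum_finset_product' (frontPairs G l B) {u ∈ B | l u = B.sup l}
    (fun u => G.neighborFinset u)
    (by simp [mem_frontPairs, and_comm, and_assoc]) (f := fun u _ => forceProb G B u)]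
  exact (sum_le_card_nsmul _ _ _ hvertex).trans_eq (nsmul_eq_mul _ _)

theorem IsLayering.sum_advancingPairs_forceProb_le (hl : IsLayering G l) {d : ℕ} (hd : 1 ≤ d)
    (hdeg : ∀ u, d ≤ G.degree u) (B : Finset V) :
    ∑ e ∈ advancingPairs G l B, forceProb G B e.1 ≤
      4 * (((layerCount l B (B.sup l) : ℝ) + 1) / d) := by
  have hpair : ∀ e ∈ advancingPairs G l B,
      forceProb G B e.1 ≤ ((layerCount l B (B.sup l) : ℝ) + 1) / d := by
    intro e he
    obtain ⟨-, heB, hel⟩ := mem_frontPairs.1 (mem_filter.1 he).1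
    have hcount : (closedBlueCount G B e.1 : ℝ) ≤ layerCount l B (B.sup l) + 1 := by
      exact_mod_cast hel ▸ hl.closedBlueCount_le heB
    exact div_le_div₀ (by positivity) hcount (by exact_mod_cast hd) (by exact_mod_cast hdeg e.1)
  have hcard : #(advancingPairs G l B) ≤ 4 := by
    refine (card_le_card fun e he => ?_).trans (hl.card_cut_le (B.sup l))
    obtain ⟨he, hel⟩ := mem_filter.1 he
    obtain ⟨hadj, -, hel'⟩ := mem_frontPairs.1 he
    exact mem_filter.2 ⟨mem_univ e, hadj, hel', hel⟩
  refine (sum_le_card_nsmul _ _ _ hpair).trans ?_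
  rw [nsmul_eq_mul]
  gcongr
  exact_mod_cast hcard

theorem IsLayering.sum_frontGain_mul_forceProb_le (hl : IsLayering G l) {d : ℕ} (hd : 1 ≤ d)
    (hdeg : ∀ u, d ≤ G.degree u) {B : Finset V} (hB : B.Nonempty) :
    ∑ e ∈ frontPairs G l B, frontGain l (layerHeight d) B e * forceProb G B e.1 ≤
      (layerCount l B (B.sup l) : ℝ) * (layerCount l B (B.sup l) + 1) /
        (7 * (layerCount l B (B.sup l) : ℝ) ^ 2) + 16 := by
  have hb : (1 : ℝ) ≤ layerCount l B (B.sup l) := by exact_mod_cast one_le_layerCount_sup hB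
  have hgap := layerHeight_sub_min_mul_le hb hd
  have hsplit : ∑ e ∈ frontPairs G l B, frontGain l (layerHeight d) B e * forceProb G B e.1 =
      (∑ e ∈ frontPairs G l B, forceProb G B e.1) / (7 * (layerCount l B (B.sup l) : ℝ) ^ 2) +
      (layerHeight d - min (layerHeight d) (growthScale (layerCount l B (B.sup l)))) *
        ∑ e ∈ advancingPairs G l B, forceProb G B e.1 := by
    simp only [frontGain, add_mul, sum_add_distrib, ite_mul, zero_mul, ← sum_filter, ← mul_sum,
      one_div_mul_eq_div, ← sum_div, advancingPairs]
  rw [hsplit]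
  gcongr
  · exact hl.sum_frontPairs_forceProb_le B
  · exact (mul_le_mul_of_nonneg_left (hl.sum_advancingPairs_forceProb_le hd hdeg B)
      (sub_nonneg.2 (min_le_left _ _))).trans hgap

theorem IsLayering.stepMean_layerPotential_le (hl : IsLayering G l) {d : ℕ} (hd : 1 ≤ d)
    (hdeg : ∀ u, d ≤ G.degree u) {B : Finset V} (hB : B.Nonempty) :
    stepMean G (fun B => ENNReal.ofReal (layerPotential l (layerHeight d) B)) B ≤
      ENNReal.ofReal (layerPotential l (layerHeight d) B) + ENNReal.ofReal 18 := by
  have hpot := layerPotential_nonneg (layerHeight_nonneg d) l hB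
  have hgain := hl.sum_frontGain_mul_forceProb_le hd hdeg hB
  have hmean := stepMean_ofReal_le G (by positivity)
    (fun e _ => frontGain_nonneg l (layerHeight d) B e)
    (fun x => hl.layerPotential_step_le (layerHeight d) x hB)
  refine hmean.trans (le_trans (ENNReal.ofReal_le_ofReal ?_) ENNReal.ofReal_add_le)
  have hb₁ : (1 : ℝ) ≤ layerCount l B (B.sup l) := by exact_mod_cast one_le_layerCount_sup hB
  set b : ℝ := (layerCount l B (B.sup l) : ℝ)
  -- The factor `7` in the growth scale estimate is the one that makes this hold for `1 ≤ b`.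
  have hshare : (b + 4) / (7 * b ^ 2) + b * (b + 1) / (7 * b ^ 2) ≤ 1 := by
    rw [← add_div, div_le_one (by positivity)]
    nlinarith
  linarith

theorem IsLayering.le_eptFrom (hl : IsLayering G l) {d : ℕ} (hd : 1 ≤ d)
    (hdeg : ∀ u, d ≤ G.degree u) {s : V} (hs : l s = 0) {M : ℕ} (hM : ∀ v, l v ≤ M)
    (hcount : d + 1 ≤ #{v | l v = M}) :
    ENNReal.ofReal (layerHeight d * (M + 1) / 18) ≤ eptFrom G {s} := by
  have hdrift := le_add_mul_eptFrom G (S := {s}) (D := ENNReal.ofReal 18) (by simp)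
    (F := fun B => ENNReal.ofReal (layerPotential l (layerHeight d) B))
    (fun B hB _ => hl.stepMean_layerPotential_le hd hdeg ⟨s, hB (mem_singleton_self s)⟩)
  rw [layerPotential_singleton_eq_zero (layerHeight_nonneg d) hs, ENNReal.ofReal_zero,
    zero_add] at hdrift
  rw [ENNReal.ofReal_div_of_pos (by norm_num)]
  exact ENNReal.div_le_of_le_mul' ((ENNReal.ofReal_le_ofReal
    (layerHeight_mul_le_layerPotential_univ hM hcount)).trans hdrift)

end FrontAdvance

section CycleDist

variable {m : ℕ}

/-- The distance from `0` in the cycle of length `m`. -/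
def cycleDist (a : Fin m) : ℕ := min a.val (m - a.val)

theorem cycleDist_le (a : Fin m) : cycleDist a ≤ m / 2 := by
  unfold cycleDist
  omega

theorem exists_cycleDist_eq [NeZero m] : ∃ a : Fin m, cycleDist a = m / 2 := by
  have := NeZero.pos m
  exact ⟨⟨m / 2, by omega⟩, by grind [cycleDist]⟩

theorem cycleDist_add_one_le [NeZero m] (a : Fin m) : cycleDist (a + 1) ≤ cycleDist a + 1 := by
  have ha := a.isLt
  have hval : (a + 1).val = (a.val + 1) % m := by simp [Fin.val_add]
  rcases (show a.val + 1 ≤ m by omega).lt_or_eq with h | h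
  · rw [Nat.mod_eq_of_lt h] at hval
    unfold cycleDist
    omega
  · rw [h, Nat.mod_self] at hval
    simp [cycleDist, hval]

theorem cycleDist_neg (a : Fin m) : cycleDist (-a) = cycleDist a := by
  have ha := a.isLt
  unfold cycleDist
  rw [Fin.val_neg']
  rcases a.val.eq_zero_or_pos with h | h
  · simp [h]
  · rw [Nat.mod_eq_of_lt (by omega)]
    omega

theorem cycleDist_add_neg_one_le [NeZero m] (a : Fin m) :
    cycleDist (a + -1) ≤ cycleDist a + 1 := by
  rw [← cycleDist_neg, ← cycleDist_neg a, neg_add, neg_neg]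
  exact cycleDist_add_one_le _

theorem card_cycleDist_sub_eq_le [NeZero m] (i : Fin m) (k : ℕ) :
    #{a : Fin m | cycleDist (a - i) = k} ≤ 2 := by
  have hcard : #{a : Fin m | cycleDist (a - i) = k} ≤ #({k, m - k} : Finset ℕ) := by
    refine card_le_card_of_injOn (fun a => (a - i).val) (fun a ha => ?_)
      fun a _ b _ h => sub_left_injective (Fin.ext h)
    have hk : cycleDist (a - i) = k := by simpa using ha
    have := (a - i).isLt
    unfold cycleDist at hk
    simp only [coe_insert, coe_singleton, Set.mem_insert_iff, Set.mem_singleton_iff]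
    omega
  exact hcard.trans card_le_two

end CycleDist

section RingOfCliques

variable {m d : ℕ} [NeZero m]

/-- The change of the clique index along an edge of the ring of cliques, in terms of the positions
of its two ends in their cliques. -/
def ringShift (m d : ℕ) [NeZero m] (j j' : Fin (d + 1)) : Fin m :=
  if j = 0 ∧ j' = Fin.last d then 1 else if j = Fin.last d ∧ j' = 0 then -1 else 0

theorem zero_ne_last (hd : 1 ≤ d) : (0 : Fin (d + 1)) ≠ Fin.last d :=
  (Fin.lt_def.2 (Nat.succ_le_iff.1 hd)).ne

theorem ringShift_ne_zero {j j' : Fin (d + 1)} (h : ringShift m d j j' ≠ 0) :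
    j = 0 ∧ j' = Fin.last d ∨ j = Fin.last d ∧ j' = 0 := by
  unfold ringShift at h
  grind

theorem ringOfCliques_adj_iff (hd : 1 ≤ d) {x y : Fin m × Fin (d + 1)} :
    (ringOfCliques m d).Adj x y ↔ x.2 ≠ y.2 ∧ y.1 = x.1 + ringShift m d x.2 y.2 := by
  have hne := zero_ne_last hd
  have hneg : y.1 = x.1 + -1 ↔ x.1 = y.1 + 1 := by
    rw [← sub_eq_add_neg, eq_sub_iff_add_eq, eq_comm]
  simp only [ringOfCliques, cliques, deletedEdges, insertedEdges, SimpleGraph.sup_adj,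
    SimpleGraph.sdiff_adj, SimpleGraph.fromRel_adj, ringShift, ne_eq, Prod.ext_iff]
  grind

theorem ringOfCliques_isRegularOfDegree (hd : 1 ≤ d) :
    (ringOfCliques m d).IsRegularOfDegree d := by
  intro x
  have hnbr : (ringOfCliques m d).neighborFinset x =
      (univ.erase x.2).image fun j => (x.1 + ringShift m d x.2 j, j) := by
    ext ⟨i, j⟩
    simp only [SimpleGraph.mem_neighborFinset, ringOfCliques_adj_iff hd, mem_image, mem_erase,
      mem_univ, and_true, Prod.mk.injEq]
    grind
  rw [← SimpleGraph.card_neighborFinset_eq_degree, hnbr,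
    card_image_of_injective _ fun j j' h => (Prod.mk.inj h).2]
  simp

theorem ringOfCliques_reachable_one (hd : 2 ≤ d) (i : Fin m) (j : Fin (d + 1)) :
    (ringOfCliques m d).Reachable (i, 1) (i, j) := by
  have hone : (1 : Fin (d + 1)) ≠ 0 ∧ (1 : Fin (d + 1)) ≠ Fin.last d := by
    simp only [ne_eq, Fin.ext_iff, Fin.val_one', Fin.val_zero, Fin.val_last,
      Nat.mod_eq_of_lt (show 1 < d + 1 by omega)]
    omega
  rcases eq_or_ne 1 j with rfl | hj
  · exact .refl _
  · exact ((ringOfCliques_adj_iff (by omega)).2 ⟨hj, by simp [ringShift, hone]⟩).reachable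

theorem ringOfCliques_reachable_add_one (hd : 2 ≤ d) (i : Fin m) :
    (ringOfCliques m d).Reachable (i, 1) (i + 1, 1) := by
  have hadj : (ringOfCliques m d).Adj (i, 0) (i + 1, Fin.last d) :=
    (ringOfCliques_adj_iff (by omega)).2 ⟨zero_ne_last (by omega), by simp [ringShift]⟩
  exact (ringOfCliques_reachable_one hd i 0).trans
    (hadj.reachable.trans (ringOfCliques_reachable_one hd (i + 1) (Fin.last d)).symm)

theorem ringOfCliques_connected (hd : 2 ≤ d) : (ringOfCliques m d).Connected := by
  have hcenter (n : ℕ) : (ringOfCliques m d).Reachable (0, 1) (Fin.ofNat m n, 1) := by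
    induction n with
    | zero => exact .refl _
    | succ n ih =>
      have hsucc : Fin.ofNat m (n + 1) = Fin.ofNat m n + 1 := by
        ext
        simp [Fin.val_add]
      exact hsucc ▸ ih.trans (ringOfCliques_reachable_add_one hd _)
  rw [SimpleGraph.connected_iff_exists_forall_reachable]
  refine ⟨(0, 1), fun ⟨i, j⟩ => .trans ?_ (ringOfCliques_reachable_one hd i j)⟩
  simpa using hcenter i.val

theorem ringOfCliques_adj_of_fst_ne (hd : 1 ≤ d) {u v : Fin m × Fin (d + 1)}
    (huv : (ringOfCliques m d).Adj u v) (hne : v.1 ≠ u.1) :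
    u.2 = 0 ∧ v.2 = Fin.last d ∨ u.2 = Fin.last d ∧ v.2 = 0 := by
  refine ringShift_ne_zero (m := m) fun h => hne ?_
  rw [((ringOfCliques_adj_iff hd).1 huv).2, h, add_zero]

theorem ringOfCliques_eq_of_adj_of_fst_ne (hd : 1 ≤ d) {u v v' : Fin m × Fin (d + 1)}
    (huv : (ringOfCliques m d).Adj u v) (hne : v.1 ≠ u.1)
    (huv' : (ringOfCliques m d).Adj u v') (hne' : v'.1 ≠ u.1) : v = v' := by
  have hpos : v.2 = v'.2 := by
    have := zero_ne_last hd
    grind [ringOfCliques_adj_of_fst_ne hd huv hne, ringOfCliques_adj_of_fst_ne hd huv' hne']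
  rw [ringOfCliques_adj_iff hd] at huv huv'
  exact Prod.ext (by rw [huv.2, huv'.2, hpos]) hpos

theorem card_ringOfCliques_cut_le (hd : 1 ≤ d) (f : Fin m → ℕ) (k : ℕ) :
    #{e : (Fin m × Fin (d + 1)) × (Fin m × Fin (d + 1)) |
      (ringOfCliques m d).Adj e.1 e.2 ∧ f e.1.1 = k ∧ f e.2.1 = k + 1} ≤
      #{a | f a = k} * 2 := by
  let gates : Finset (Fin (d + 1)) := {0, Fin.last d}
  refine (card_le_card_of_injOn (t := ({a | f a = k} : Finset (Fin m)) ×ˢ gates) Prod.fst ?_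
    ?_).trans ((card_product _ _).trans_le (Nat.mul_le_mul_left _ card_le_two))
  · intro e he
    obtain ⟨hadj, hk, hk'⟩ := (mem_filter.1 he).2
    have hne : e.2.1 ≠ e.1.1 := fun h => by rw [h] at hk'; omega
    have := ringOfCliques_adj_of_fst_ne hd hadj hne
    simp only [gates, coe_product, Set.mem_prod, mem_coe, mem_filter, mem_univ, true_and,
      mem_insert, mem_singleton]
    tauto
  · rintro ⟨u, v⟩ he ⟨_, v'⟩ he' rfl
    obtain ⟨hadj, hk, hk'⟩ := (mem_filter.1 he).2
    obtain ⟨hadj', -, hk''⟩ := (mem_filter.1 he').2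
    have hv : v = v' := ringOfCliques_eq_of_adj_of_fst_ne hd hadj (fun h => by grind) hadj'
      (fun h => by grind)
    rw [hv]

theorem ringOfCliques_isLayering (hd : 1 ≤ d) (i : Fin m) :
    IsLayering (ringOfCliques m d) fun x => cycleDist (x.1 - i) where
  le_add_one {u v} huv := by
    rw [((ringOfCliques_adj_iff hd).1 huv).2, add_sub_right_comm]
    unfold ringShift
    split_ifs
    · exact cycleDist_add_one_le _
    · exact cycleDist_add_neg_one_le _
    · simp
  card_outside_le u := by
    refine card_le_one.2 fun v hv v' hv' => ?_
    obtain ⟨huv, hne⟩ := (mem_filter.1 hv).2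
    obtain ⟨huv', hne'⟩ := (mem_filter.1 hv').2
    exact ringOfCliques_eq_of_adj_of_fst_ne hd huv (fun h => hne (by rw [h]))
      huv' (fun h => hne' (by rw [h]))
  card_cut_le k := (card_ringOfCliques_cut_le hd (fun a => cycleDist (a - i)) k).trans
    (Nat.mul_le_mul_right 2 (card_cycleDist_sub_eq_le i k))

theorem add_one_le_card_cycleDist_eq (m d : ℕ) [NeZero m] (i : Fin m) :
    d + 1 ≤ #{x : Fin m × Fin (d + 1) | cycleDist (x.1 - i) = m / 2} := by
  obtain ⟨a, ha⟩ := exists_cycleDist_eq (m := m)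
  calc d + 1 = #(({a + i} : Finset (Fin m)) ×ˢ (univ : Finset (Fin (d + 1)))) := by simp
    _ ≤ _ := card_le_card fun x hx => by
      have hx₁ : x.1 = a + i := mem_singleton.1 (mem_product.1 hx).1
      simp [hx₁, ha]

theorem le_ept_ringOfCliques (hd : 3 ≤ d) :
    ENNReal.ofReal (1 / 96 * (((m * (d + 1) : ℕ) : ℝ) * (Real.log (Real.log d) / d))) ≤
      ept (ringOfCliques m d) := by
  refine le_iInf fun s => (ENNReal.ofReal_le_ofReal ?_).trans
    ((ringOfCliques_isLayering (d := d) (by omega) s.1).le_eptFrom (by omega)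
      (fun u => (ringOfCliques_isRegularOfDegree (by omega) u).ge) (by simp [cycleDist])
      (fun v => cycleDist_le _) (add_one_le_card_cycleDist_eq m d s.1))
  have hd' : (3 : ℝ) ≤ d := by exact_mod_cast hd
  have hheight := layerHeight_nonneg d
  have hloglog := log_log_le_two_mul_layerHeight (show 2 ≤ d by omega)
  have hm : (m : ℝ) ≤ 2 * (((m / 2 : ℕ) : ℝ) + 1) := by
    exact_mod_cast (by omega : m ≤ 2 * (m / 2 + 1))
  have hratio : ((d : ℝ) + 1) / d ≤ 4 / 3 := by
    rw [div_le_div_iff₀ (by linarith) (by norm_num)]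
    linarith
  push_cast at hm ⊢
  calc 1 / 96 * ((m : ℝ) * (d + 1) * (Real.log (Real.log d) / d))
      = 1 / 96 * m * (((d : ℝ) + 1) / d) * Real.log (Real.log d) := by ring
    _ ≤ 1 / 96 * m * (((d : ℝ) + 1) / d) * (2 * layerHeight d) := by gcongr
    _ ≤ 1 / 96 * (2 * (((m / 2 : ℕ) : ℝ) + 1)) * (4 / 3) * (2 * layerHeight d) := by gcongr
    _ = layerHeight d * (((m / 2 : ℕ) : ℝ) + 1) / 18 := by ring

end RingOfCliques

end ZeroForcing

theorem theorem2_general :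
    (∃ C : ℝ, 0 < C ∧ ∀ (δ Δ : ℕ), 1 ≤ δ → 2 ≤ Δ →
      ∀ (V : Type*) [Fintype V] [DecidableEq V] (G : SimpleGraph V) [DecidableRel G.Adj],
        G.Connected → (∀ u, δ ≤ G.degree u) → (∀ u, G.degree u ≤ Δ) → ∀ s : V,
          ZeroForcing.eptFrom G {s} ≤
            ENNReal.ofReal (C * ((Fintype.card V : ℝ) * (Real.log Δ / δ)))) ∧
    (∃ A : ℝ, 0 < A ∧ ∀ (δ Δ : ℕ), 1 ≤ δ → 3 ≤ Δ →
      ∀ (V : Type*) [Fintype V] [DecidableEq V] (G : SimpleGraph V) [DecidableRel G.Adj],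
        G.Connected → (∀ u, δ ≤ G.degree u) → (∀ u, G.degree u ≤ Δ) → ∀ s : V,
          ZeroForcing.eptFrom G {s} ≤
            ENNReal.ofReal (60 * (Real.log (((Δ : ℝ) + 1) / 3) / ((δ : ℝ) + 1)) *
              (Fintype.card V : ℝ) + A * Real.log (Fintype.card V : ℝ))) ∧
    (∃ c : ℝ, 0 < c ∧ ∀ (d : ℕ), 3 ≤ d → ∀ (m : ℕ) [NeZero m],
      (ZeroForcing.ringOfCliques m d).Connected ∧
      (ZeroForcing.ringOfCliques m d).IsRegularOfDegree d ∧
      ENNReal.ofReal (c * (((m * (d + 1) : ℕ) : ℝ) * (Real.log (Real.log d) / d))) ≤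
        ZeroForcing.ept (ZeroForcing.ringOfCliques m d)) :=
  ⟨⟨40, by norm_num, fun _ _ hδ hΔ _ _ _ _ _ hG hmin hmax s =>
      ZeroForcing.eptFrom_le_const_mul hG hδ hΔ hmin hmax s⟩,
    ⟨16, by norm_num, fun _ _ hδ hΔ _ _ _ _ _ hG hmin hmax s =>
      ZeroForcing.eptFrom_le_explicit hG hδ hΔ hmin hmax s⟩,
    ⟨1 / 96, by norm_num, fun _ hd _ _ => ⟨ZeroForcing.ringOfCliques_connected (by omega),
      ZeroForcing.ringOfCliques_isRegularOfDegree (by omega),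
      ZeroForcing.le_ept_ringOfCliques hd⟩⟩⟩

theorem theorem2 :
    -- the upper bound, with an absolute constant
    (∃ C : ℝ, 0 < C ∧ ∀ (d : ℕ), 2 ≤ d →
      ∀ (V : Type*) [Fintype V] [DecidableEq V] (G : SimpleGraph V) [DecidableRel G.Adj],
        G.Connected → G.IsRegularOfDegree d →
          ZeroForcing.ept G ≤
            ENNReal.ofReal (C * ((Fintype.card V : ℝ) * (Real.log d / d)))) ∧
    -- its explicit form, with an absolute constant in the logarithmic error term
    (∃ A : ℝ, 0 < A ∧ ∀ (d : ℕ), 3 ≤ d →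
      ∀ (V : Type*) [Fintype V] [DecidableEq V] (G : SimpleGraph V) [DecidableRel G.Adj],
        G.Connected → G.IsRegularOfDegree d →
          ZeroForcing.ept G ≤
            ENNReal.ofReal (60 * (Real.log (((d : ℝ) + 1) / 3) / ((d : ℝ) + 1)) *
              (Fintype.card V : ℝ) + A * Real.log (Fintype.card V : ℝ))) ∧
    -- the lower bound for the rings of cliques, on `n = m (d + 1)` vertices
    (∃ c : ℝ, 0 < c ∧ ∀ (d : ℕ), 3 ≤ d → ∀ (m : ℕ) [NeZero m],
      (ZeroForcing.ringOfCliques m d).Connected ∧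
      (ZeroForcing.ringOfCliques m d).IsRegularOfDegree d ∧
      ENNReal.ofReal (c * (((m * (d + 1) : ℕ) : ℝ) * (Real.log (Real.log d) / d))) ≤
        ZeroForcing.ept (ZeroForcing.ringOfCliques m d)) := by
  obtain ⟨⟨C, hC, hupper⟩, ⟨A, hA, hexplicit⟩, hlower⟩ := theorem2_general
  refine ⟨⟨C, hC, fun d hd V _ _ G _ hG hreg => hG.nonempty.elim fun s => ?_⟩,
    ⟨A, hA, fun d hd V _ _ G _ hG hreg => hG.nonempty.elim fun s => ?_⟩, hlower⟩
  · exact (iInf_le _ s).trans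
      (hupper d d (by omega) hd V G hG (fun u => (hreg u).ge) (fun u => (hreg u).le) s)
  · exact (iInf_le _ s).trans
      (hexplicit d d (by omega) hd V G hG (fun u => (hreg u).ge) (fun u => (hreg u).le) s)
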